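/- **Setting.** Let $M\ge 1$, $L,K\ge 0$ be integers. A complex random variable $h$ is *Rician with factor $\kappa\ge 0$* if $h=(\sqrt{\kappa}\,a+z)/\sqrt{\kappa+1}$ in law, with $a\in\mathbb C$ deterministic, $|a|=1$, and $z\sim\mathcal{CN}(0,1)$. A transmitter with $M$ antennas, power $P_S>0$ and path loss $\ell_S>0$ has channel coefficients $g_m=\sqrt{\ell_S}\,h_m e^{j\theta_m}$ ($\theta_m\in\mathbb R$), where $h_1,\dots,h_M$ are independent Rician variables with common factor $\kappa_S>0$, and uses maximum-ratio transmission $w_m=\frac{|g_m|}{\|g\|}e^{j\angle g_m}$. Let $\gamma=|g^{\mathsf H}w|^2/\ell_S$ be the normalized power gain, $\mu_1=\mathbb E[\gamma]$, $\mu_2=\mathbb E[\gamma^2]$. The receiver has noise variance $\sigma_U^2>0$, and $\bar\gamma=P_S\ell_S/\sigma_U^2$. The $l$-th aerial interferer ($1\le l\le L$) has average interference-to-noise ratio $\bar\gamma_{I_l}=P_{I_l}\ell_{I_l}/\sigma_U^2$ and Rician fading coefficient $h_{I_l}$ with factor $\kappa_{I_l}\ge 0$; the $k$-th ground interferer ($1\le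 k\le K$) likewise has $\bar\gamma_{J_k}$, $h_{J_k}$, $\kappa_{J_k}$ (powers $\ge 0$, path losses $>0$; parameters may differ between interferers). **Moment-matched law.** Let $\psi>1$ with $M\psi\in\mathbb N$, and put $$\Omega=\sqrt{\tfrac{\psi}{\psi-1}}\,\frac{\sqrt{\mu_1^2(M+1)-M\mu_2}}{M},\quad \sigma^2=\frac{\mu_1-M\Omega}{M},\quad \kappa=\frac{1-\sigma^2}{\sigma^2},\quad \omega=\frac{\Omega(\kappa+1)}{\kappa},\quad \xi=\frac{\kappa\omega}{\psi},\quad \alpha=\frac{\xi+1}{\kappa+1},$$ $$\chi_{M,k}=\binom{M\psi-M}{k}\frac{1}{(\xi+1)^k}\Big(\frac{\xi}{\xi+1}\Big)^{M\psi-M-k}.$$ Assume $\sigma^2>0$. Let $Y=\sum_{i=1}^M X_i$, where $X_i$ is shadowed Rician: $X_i=(A_i+\xi_ip_i)^2+(B_i+\xi_iq_i)^2$ in law, with $p_i^2+q_i^2=1$ and independent $A_i,B_i\sim\mathcal N(0,\sigma^2/2)$ and $\xi_i$ Nakagami with shape $\psi$ and $\mathbb E[\xi_i^2]=\Omega$.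 Assume that all $X_i$, $h_{I_l}$, $h_{J_k}$ are mutually independent. The ground-to-air SINR with $\gamma$ replaced by its representation $Y$ is $$\Gamma=\frac{\bar\gamma\,Y}{\sum_{l}\bar\gamma_{I_l}|h_{I_l}|^2+\sum_{k}\bar\gamma_{J_k}|h_{J_k}|^2+1}.$$ **Claim.** (a) $\mathbb E[Y]=\mu_1=M$ and $\mathbb E[Y^2]=\mu_2=M^2+\dfrac{M(2\kappa_S+1)}{(\kappa_S+1)^2}$. (b) For every $x>0$, with $s_0=\dfrac{x}{\alpha\bar\gamma}$, $$F_\Gamma(x)=\Pr(\Gamma\le x)=1-\sum_{k=0}^{M\psi-M}\chi_{M,k}\sum_{n=0}^{M\psi-k-1}\frac{(-s_0)^n\,\Delta^{(n)}(s_0)}{n!},$$ where, with $b_{I_l}=\bar\gamma_{I_l}/(1+\kappa_{I_l})$ and $b_{J_k}=\bar\gamma_{J_k}/(1+\kappa_{J_k})$, $$\Delta^{(n)}(s)=\frac{d^n}{ds^n}\left[e^{-s}\prod_{l=1}^L\frac{e^{-\kappa_{I_l}+\frac{\kappa_{I_l}}{1+b_{I_l}s}}}{1+b_{I_l}s}\prod_{k=1}^K\frac{e^{-\kappa_{J_k}+\frac{\kappa_{J_k}}{1+b_{J_k}s}}}{1+b_{J_k}s}\right].$$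 (c) For all $n\ge 0$ and $s\ge 0$, $$\Delta^{(n)}(s)=\Delta^{(0)}(s)\sum_{p}\frac{n!}{\prod_{i}p_i!}\prod_{i}\frac{S_{p_{\langle i\rangle}}(s)^{\nu_i}}{\nu_i!},$$ where $p$ runs over the partitions $p_1+\dots+p_r=n$ into positive integers (unordered, any number $r$ of parts; only the empty partition if $n=0$), $p_{\langle i\rangle}$ are the distinct parts of $p$ and $\nu_i$ their multiplicities, $S_i(s)=\sum_l\delta^{(i)}_{I_l}(s)+\sum_k\delta^{(i)}_{J_k}(s)-C_i$ with $C_1=1$, $C_i=0$ for $i\ge2$, and $\delta^{(i)}(s)=(i-1)!\,\frac{(-b)^i}{(1+bs)^i}\big(1+\frac{i\kappa}{1+bs}\big)$ with the respective $b,\kappa$. -/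

import Mathlib

open MeasureTheory ProbabilityTheory

noncomputable section

namespace G2A

/-! ### Rician fading -/

/-- The circularly symmetric complex Gaussian law `CN(0, v)`: independent real and imaginary
parts, each `N(0, v/2)`. -/
def circularGaussian (v : ℝ) : Measure ℂ :=
  ((gaussianReal 0 (v / 2).toNNReal).prod (gaussianReal 0 (v / 2).toNNReal)).map
    (fun t : ℝ × ℝ => (⟨t.1, t.2⟩ : ℂ))

/-- The law of the small-scale fading coefficient `(√κ a + z) / √(κ + 1)`, with line-of-sight
component `a` and scattering component `z ~ CN(0, 1)`; `κ` is the Rician `K`-factor. -/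
def ricianLaw (κ : ℝ) (a : ℂ) : Measure ℂ :=
  (circularGaussian 1).map
    (fun z => (((Real.sqrt κ : ℝ) : ℂ) * a + z) / ((Real.sqrt (κ + 1) : ℝ) : ℂ))

/-- `h` is a Rician fading coefficient with `K`-factor `κ`: its line-of-sight component is
deterministic and of unit modulus. -/
def IsRician {Ω : Type*} [MeasurableSpace Ω] (P : Measure Ω) (κ : ℝ) (h : Ω → ℂ) : Prop :=
  ∃ a : ℂ, ‖a‖ = 1 ∧ HasLaw h (ricianLaw κ a) P

/-- The channel coefficient `√ℓ h e^{jθ}` with path loss `ℓ` and (Doppler) phase `θ`. -/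
def channel (ℓ θ : ℝ) (h : ℂ) : ℂ :=
  ((Real.sqrt ℓ : ℝ) : ℂ) * h * Complex.exp (θ * Complex.I)

/-! ### Maximum-ratio transmission -/

/-- The `m`-th weight of the MRT beamformer for the channel vector `g`. -/
def mrtWeight {M : ℕ} (g : Fin M → ℂ) (m : Fin M) : ℂ :=
  ((‖g m‖ / Real.sqrt (∑ j, ‖g j‖ ^ 2) : ℝ) : ℂ) * Complex.exp (Complex.arg (g m) * Complex.I)

/-- The received power gain `|gᴴ w|²` under MRT beamforming. -/
def mrtPowerGain {M : ℕ} (g : Fin M → ℂ) : ℝ :=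
  ‖∑ m, star (g m) * mrtWeight g m‖ ^ 2

/-- The average signal-to-noise ratio of a link with transmit power `p`, path loss `ℓ` and noise
variance `N`. -/
def avgSNR (p ℓ N : ℝ) : ℝ := p * ℓ / N

/-! ### Shadowed Rician law -/

/-- The Nakagami-`m` law with shape `m` and spread `w = E[ξ²]`: the law of the square root of a
Gamma variable of shape `m` and mean `w`. -/
def nakagamiLaw (m w : ℝ) : Measure ℝ := (gammaMeasure m (m / w)).map Real.sqrt

/-- The shadowed Rician law: the law of `(A + ξ p)² + (B + ξ q)²` with independent
`A, B ~ N(0, σ²/2)` and `ξ` Nakagami of shape `ψ` and spread `w`. -/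
def shadowedRicianLaw (σ2 ψ w p q : ℝ) : Measure ℝ :=
  ((gaussianReal 0 (σ2 / 2).toNNReal).prod
      ((gaussianReal 0 (σ2 / 2).toNNReal).prod (nakagamiLaw ψ w))).map
    (fun t : ℝ × ℝ × ℝ => (t.1 + t.2.2 * p) ^ 2 + (t.2.1 + t.2.2 * q) ^ 2)

/-! ### Moment-matched parameters of a sum of `I` independent shadowed Rician variables
`μ₁`, `μ₂` are the first two moments to be matched and `ψ` is the shape parameter. -/

/-- The spread `Ω` of the Nakagami component. -/
def sisrSpread (I : ℕ) (ψ μ₁ μ₂ : ℝ) : ℝ :=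
  Real.sqrt ψ / Real.sqrt (ψ - 1) * (Real.sqrt (μ₁ ^ 2 * (I + 1) - I * μ₂) / I)

/-- The power `σ²` of the Gaussian component. -/
def sisrSigmaSq (I : ℕ) (ψ μ₁ μ₂ : ℝ) : ℝ := (μ₁ - I * sisrSpread I ψ μ₁ μ₂) / I

/-- `κ = (1 - σ²) / σ²`. -/
def sisrKappa (I : ℕ) (ψ μ₁ μ₂ : ℝ) : ℝ :=
  (1 - sisrSigmaSq I ψ μ₁ μ₂) / sisrSigmaSq I ψ μ₁ μ₂

/-- `ω = Ω (κ + 1) / κ`. -/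
def sisrOmega (I : ℕ) (ψ μ₁ μ₂ : ℝ) : ℝ :=
  sisrSpread I ψ μ₁ μ₂ * (sisrKappa I ψ μ₁ μ₂ + 1) / sisrKappa I ψ μ₁ μ₂

/-- `ξ = κ ω / ψ`. -/
def sisrXi (I : ℕ) (ψ μ₁ μ₂ : ℝ) : ℝ := sisrKappa I ψ μ₁ μ₂ * sisrOmega I ψ μ₁ μ₂ / ψ

/-- `α = (ξ + 1) / (κ + 1)`. -/
def sisrAlpha (I : ℕ) (ψ μ₁ μ₂ : ℝ) : ℝ :=
  (sisrXi I ψ μ₁ μ₂ + 1) / (sisrKappa I ψ μ₁ μ₂ + 1)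

/-- The coefficient `χ_{I,k}`, where `N` is the integer `I ψ`. -/
def sisrChi (I N : ℕ) (ψ μ₁ μ₂ : ℝ) (k : ℕ) : ℝ :=
  ((N - I).choose k : ℝ) * (1 / (sisrXi I ψ μ₁ μ₂ + 1) ^ k) *
    (sisrXi I ψ μ₁ μ₂ / (sisrXi I ψ μ₁ μ₂ + 1)) ^ (N - I - k)

/-! ### Interference -/

/-- The Laplace transform `E[exp(-s γ |h|²)]` of an interferer with average interference-to-noise
ratio `γ` and `K`-factor `κ`, as an explicit function. -/
def interfererLaplace (γ κ s : ℝ) : ℝ :=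
  Real.exp (-κ + κ / (1 + γ / (1 + κ) * s)) / (1 + γ / (1 + κ) * s)

/-- `Δ⁽ⁿ⁾(s)`: the `n`-th derivative of `e^{-s}` times the interferers' Laplace transforms. -/
def delta {L K : ℕ} (γI κI : Fin L → ℝ) (γJ κJ : Fin K → ℝ) (n : ℕ) (s : ℝ) : ℝ :=
  iteratedDeriv n (fun t => Real.exp (-t) * (∏ l, interfererLaplace (γI l) (κI l) t) *
    ∏ k, interfererLaplace (γJ k) (κJ k) t) s

/-- `δ⁽ⁱ⁾(s) = (i-1)! (-b)ⁱ / (1 + b s)ⁱ (1 + i κ / (1 + b s))` with `b = γ / (1 + κ)`, for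
`i ≥ 1`. -/
def smallDelta (γ κ : ℝ) (i : ℕ) (s : ℝ) : ℝ :=
  ((i - 1).factorial : ℝ) * ((-(γ / (1 + κ))) ^ i / (1 + γ / (1 + κ) * s) ^ i) *
    (1 + i * κ / (1 + γ / (1 + κ) * s))

/-- `S_i(s) = ∑_l δ⁽ⁱ⁾_{I_l}(s) + ∑_k δ⁽ⁱ⁾_{J_k}(s) - C_i`, with `C_1 = 1` and `C_i = 0` for
`i ≥ 2`. -/
def bigS {L K : ℕ} (γI κI : Fin L → ℝ) (γJ κJ : Fin K → ℝ) (i : ℕ) (s : ℝ) : ℝ :=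
  ∑ l, smallDelta (γI l) (κI l) i s + ∑ k, smallDelta (γJ k) (κJ k) i s - (if i = 1 then 1 else 0)

/-- The explicit expansion of `Δ⁽ⁿ⁾(s)`: a sum over the partitions `p₁ + ⋯ + p_r = n` into
positive parts, with the distinct parts taken with their multiplicities. -/
def deltaExpansion {L K : ℕ} (γI κI : Fin L → ℝ) (γJ κJ : Fin K → ℝ) (n : ℕ) (s : ℝ) : ℝ :=
  (Real.exp (-s) * (∏ l, interfererLaplace (γI l) (κI l) s) *
      ∏ k, interfererLaplace (γJ k) (κJ k) s) *
    ∑ p : n.Partition,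
      (n.factorial : ℝ) *
        (∏ i ∈ p.parts.toFinset,
          bigS γI κI γJ κJ i s ^ p.parts.count i / ((p.parts.count i).factorial : ℝ)) /
        (p.parts.map (fun i => (i.factorial : ℝ))).prod

/-- The SINR `γ̄ Y / (∑_l γI_l |hI_l|² + ∑_k γJ_k |hJ_k|² + 1)`. -/
def sinr {L K : ℕ} (γ : ℝ) (γI : Fin L → ℝ) (γJ : Fin K → ℝ) (Y : ℝ) (hI : Fin L → ℂ)
    (hJ : Fin K → ℂ) : ℝ :=
  γ * Y / (∑ l, γI l * ‖hI l‖ ^ 2 + ∑ k, γJ k * ‖hJ k‖ ^ 2 + 1)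

end G2A

end

open MeasureTheory ProbabilityTheory

noncomputable section

namespace G2A

open scoped NNReal ENNReal Topology

/-! ### Gaussian integrals -/

/-! Everything rests on Laplace transforms. Conditionally on its Nakagami component `ξ`, a shadowed
Rician variable is a sum of two squared shifted Gaussians, with transform `exp(-ξ² t / (1 + σ² t)) /
(1 + σ² t)`. Since `ξ²` is a Gamma variable, averaging gives `((1 + σ² t) / (1 + α t))^ψ / (1 + σ²
t)` with `α = σ² + Ω / ψ`. The `M`-th power is `(1 + σ² t)^(N - M) / (1 + α t)^N`, where `N = M ψ`
is an integer. Expanding `1 + σ² t` around `1 + α t` by the binomial theorem exhibits the transform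
of a finite mixture of Erlang laws of shapes `N - k`, so by uniqueness `Y` has that law
(`map_sum_shadowedRician`).

Given the noise-plus-interference `W`, the event `Γ > x` is an Erlang tail at a multiple of `W`, a
sum of terms `e^{-s₀ W} (s₀ W)^n / n!`. Their means are derivatives at `s₀` of the Laplace transform
of `W`, which is `Δ⁽⁰⁾` (`cdf_mul_div_of_mixture`, `mgf_interference`). These derivatives have a
closed form because `Δ⁽⁰⁾` has logarithmic derivative `S₁` and `Sᵢ' = Sᵢ₊₁`: Leibniz' rule then
yields the recurrence of the complete Bell polynomials, which are sums over partitions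
(`iteratedDeriv_eq_mul_partitionSum`).

For the moments, the MRT gain is `∑ ‖h_m‖²`, whose terms have mean 1. The matched parameters satisfy
`σ² + Ω = 1` and `Ω² (ψ - 1) / ψ = (κ_S / (κ_S + 1))²`, which give each `X i` the mean and second
moment of `‖h_m‖²`. -/

lemma gaussianPDFReal_mul_exp_neg_sq (m t : ℝ) (ht : 0 ≤ t) {v w : ℝ≥0} (hv : v ≠ 0)
    (hw : (w : ℝ) = v / (1 + 2 * v * t)) (x : ℝ) :
    gaussianPDFReal m v x * Real.exp (-t * x ^ 2) =
      Real.exp (-(m ^ 2 * t) / (1 + 2 * v * t)) / Real.sqrt (1 + 2 * v * t) *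
        gaussianPDFReal (m / (1 + 2 * v * t)) w x := by
  have hv0 : (0 : ℝ) < v := by positivity
  have hD : (0 : ℝ) < 1 + 2 * v * t := by positivity
  simp only [gaussianPDFReal, hw]
  have hs : Real.sqrt (2 * Real.pi * (v / (1 + 2 * v * t))) =
      Real.sqrt (2 * Real.pi * v) / Real.sqrt (1 + 2 * v * t) := by
    rw [← Real.sqrt_div (by positivity)]; congr 1; ring
  have h1 : 0 < Real.sqrt (1 + 2 * v * t) := Real.sqrt_pos.2 hD
  have h2 : 0 < Real.sqrt (2 * Real.pi * v) := Real.sqrt_pos.2 (by positivity)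
  rw [hs, mul_assoc, ← Real.exp_add, inv_div]
  -- Completing the square: the tilted Gaussian is centred at `m / (1 + 2vt)` with variance `v / (1
  -- + 2vt)`.
  have he : -(x - m) ^ 2 / (2 * v) + -t * x ^ 2 = -(m ^ 2 * t) / (1 + 2 * v * t) +
      -(x - m / (1 + 2 * v * t)) ^ 2 / (2 * (v / (1 + 2 * v * t))) := by
    field_simp
    ring
  rw [he, Real.exp_add]
  field_simp

lemma integral_exp_neg_sq_gaussianReal (m t : ℝ) (ht : 0 ≤ t) {v : ℝ≥0} (hv : v ≠ 0) :
    ∫ x, Real.exp (-t * x ^ 2) ∂gaussianReal m v =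
      Real.exp (-(m ^ 2 * t) / (1 + 2 * v * t)) / Real.sqrt (1 + 2 * v * t) := by
  have hv0 : (0 : ℝ) < v := by positivity
  have hD : (0 : ℝ) < 1 + 2 * v * t := by positivity
  let w : ℝ≥0 := ⟨v / (1 + 2 * v * t), by positivity⟩
  have hw : (w : ℝ) = v / (1 + 2 * v * t) := rfl
  have hw0 : w ≠ 0 := by
    intro h
    have : (w : ℝ) = 0 := by rw [h]; rfl
    rw [hw] at this
    exact (div_pos hv0 hD).ne' this
  rw [integral_gaussianReal_eq_integral_smul hv]
  simp_rw [smul_eq_mul, gaussianPDFReal_mul_exp_neg_sq m t ht hv hw]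
  rw [integral_const_mul, integral_gaussianPDFReal_eq_one _ hw0, mul_one]

lemma integral_exp_neg_add_sq_gaussianReal (m t : ℝ) (ht : 0 ≤ t) {v : ℝ≥0} (hv : v ≠ 0) :
    ∫ x, Real.exp (-t * (x + m) ^ 2) ∂gaussianReal 0 v =
      Real.exp (-(m ^ 2 * t) / (1 + 2 * v * t)) / Real.sqrt (1 + 2 * v * t) := by
  rw [← integral_exp_neg_sq_gaussianReal m t ht hv]
  have h := gaussianReal_map_add_const (μ := 0) (v := v) m
  rw [zero_add] at h
  rw [← h, integral_map (by fun_prop) (by fun_prop)]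

lemma integral_exp_neg_add_sq_prod_gaussianReal (a b t : ℝ) (ht : 0 ≤ t) {v : ℝ≥0} (hv : v ≠ 0) :
    ∫ x, Real.exp (-t * ((x.1 + a) ^ 2 + (x.2 + b) ^ 2))
        ∂(gaussianReal 0 v).prod (gaussianReal 0 v) =
      Real.exp (-((a ^ 2 + b ^ 2) * t) / (1 + 2 * v * t)) / (1 + 2 * v * t) := by
  have hv0 : (0 : ℝ) < v := by positivity
  have hD : (0 : ℝ) < 1 + 2 * v * t := by positivity
  simp_rw [mul_add, Real.exp_add]
  rw [integral_prod_mul (fun x : ℝ => Real.exp (-t * (x + a) ^ 2))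
    (fun x : ℝ => Real.exp (-t * (x + b) ^ 2)), integral_exp_neg_add_sq_gaussianReal a t ht hv,
    integral_exp_neg_add_sq_gaussianReal b t ht hv, div_mul_div_comm, ← Real.exp_add,
    Real.mul_self_sqrt hD.le]
  congr 2
  ring

lemma hasDerivAt_poly_mul_exp_sq {p : ℝ → ℝ} {p' v t : ℝ} (hp : HasDerivAt p p' t) :
    HasDerivAt (fun s => p s * Real.exp (v * s ^ 2 / 2))
      ((p' + v * t * p t) * Real.exp (v * t ^ 2 / 2)) t := by
  have h : HasDerivAt (fun s : ℝ => v * s ^ 2 / 2) (v * t) t := by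
    convert! ((hasDerivAt_pow 2 t).const_mul v).div_const 2 using 1
    push_cast; ring
  convert! hp.mul h.exp using 1
  ring

/-- Differentiating under the integral sign in `t` brings down one factor `x`. Keeping `t` free
allows iteration; the moments are the values at `t = 0`. -/
lemma integral_pow_succ_mul_exp_gaussianReal {v : ℝ≥0} {n : ℕ} {p p' : ℝ → ℝ}
    (hn : ∀ t, ∫ x, x ^ n * Real.exp (t * x) ∂gaussianReal 0 v = p t * Real.exp (v * t ^ 2 / 2))
    (hp : ∀ t, HasDerivAt p (p' t) t) (t : ℝ) :
    ∫ x, x ^ (n + 1) * Real.exp (t * x) ∂gaussianReal 0 v =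
      (p' t + v * t * p t) * Real.exp (v * t ^ 2 / 2) := by
  have h := hasDerivAt_integral_pow_mul_exp_real (X := id) (μ := gaussianReal 0 v) (t := t)
    (by simp) n
  simp only [id, hn] at h
  exact h.unique (hasDerivAt_poly_mul_exp_sq (hp t))

lemma integral_pow_gaussianReal (v : ℝ≥0) :
    ∫ x, x ∂gaussianReal 0 v = 0 ∧ ∫ x, x ^ 2 ∂gaussianReal 0 v = v ∧
      ∫ x, x ^ 3 ∂gaussianReal 0 v = 0 ∧ ∫ x, x ^ 4 ∂gaussianReal 0 v = 3 * (v : ℝ) ^ 2 := by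
  have h0 : ∀ t, ∫ x, x ^ 0 * Real.exp (t * x) ∂gaussianReal 0 v =
      1 * Real.exp (v * t ^ 2 / 2) := fun t => by
    have := congrFun (mgf_fun_id_gaussianReal (μ := 0) (v := v)) t
    simpa [mgf] using this
  have h1 := integral_pow_succ_mul_exp_gaussianReal (p := fun _ => 1) h0
    (fun t => hasDerivAt_const t 1)
  -- The prefactors keep the unsimplified form produced by the recurrence, so that the previous step
  -- fits as it stands.
  have h2 := integral_pow_succ_mul_exp_gaussianReal (p' := fun _ => (v : ℝ))
    (p := fun t => 0 + v * t * 1) h1 (fun t => by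
      convert! (((hasDerivAt_id t).const_mul (v : ℝ)).mul_const 1).const_add 0 using 1; simp)
  have h3 := integral_pow_succ_mul_exp_gaussianReal (p' := fun t => (v : ℝ) ^ 2 * (2 * t))
    (p := fun t => v + v * t * (0 + v * t * 1)) h2 (fun t => by
      convert! (((hasDerivAt_pow 2 t).const_mul ((v : ℝ) ^ 2)).const_add (v : ℝ)) using 1
      · ext s; ring
      · simp)
  have h4 := integral_pow_succ_mul_exp_gaussianReal
    (p' := fun t => 3 * (v : ℝ) ^ 2 + (v : ℝ) ^ 3 * (3 * t ^ 2))
    (p := fun t => (v : ℝ) ^ 2 * (2 * t) + v * t * (v + v * t * (0 + v * t * 1))) h3 (fun t => by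
      convert! (((hasDerivAt_id t).const_mul (3 * (v : ℝ) ^ 2))).add
        ((hasDerivAt_pow 3 t).const_mul ((v : ℝ) ^ 3)) using 1
      · ext s; simp
        ring
      · simp)
  refine ⟨by simp, by simpa using h2 0, by simpa using h3 0, by simpa using h4 0⟩

lemma integrable_pow_gaussianReal (m : ℝ) (v : ℝ≥0) (n : ℕ) :
    Integrable (fun x => x ^ n) (gaussianReal m v) := by
  refine integrable_pow_of_mem_interior_integrableExpSet (X := id) ?_ n
  simp

lemma integral_add_sq_gaussianReal (a : ℝ) (v : ℝ≥0) :
    ∫ x, (x + a) ^ 2 ∂gaussianReal 0 v = v + a ^ 2 := by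
  obtain ⟨h1, h2, -, -⟩ := integral_pow_gaussianReal v
  have i1 : Integrable (fun x => x) (gaussianReal 0 v) := by
    simpa using integrable_pow_gaussianReal 0 v 1
  have i2 := integrable_pow_gaussianReal 0 v 2
  have : ∀ x : ℝ, (x + a) ^ 2 = x ^ 2 + (2 * a) * x + a ^ 2 := fun x => by ring
  simp_rw [this]
  have j1 := i1.const_mul (2 * a)
  have j2 : Integrable (fun x => x ^ 2 + (2 * a) * x) (gaussianReal 0 v) := i2.add j1
  rw [integral_add j2 (integrable_const _), integral_add i2 j1, integral_const_mul, h1, h2]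
  simp

lemma integral_add_pow_four_gaussianReal (a : ℝ) (v : ℝ≥0) :
    ∫ x, (x + a) ^ 4 ∂gaussianReal 0 v = 3 * (v : ℝ) ^ 2 + 6 * v * a ^ 2 + a ^ 4 := by
  obtain ⟨h1, h2, h3, h4⟩ := integral_pow_gaussianReal v
  have i1 : Integrable (fun x => x) (gaussianReal 0 v) := by
    simpa using integrable_pow_gaussianReal 0 v 1
  have i2 := integrable_pow_gaussianReal 0 v 2
  have i3 := integrable_pow_gaussianReal 0 v 3
  have i4 := integrable_pow_gaussianReal 0 v 4
  have : ∀ x : ℝ, (x + a) ^ 4 =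
      x ^ 4 + (4 * a) * x ^ 3 + (6 * a ^ 2) * x ^ 2 + (4 * a ^ 3) * x + a ^ 4 := fun x => by ring
  simp_rw [this]
  have j1 := i1.const_mul (4 * a ^ 3)
  have j2 := i2.const_mul (6 * a ^ 2)
  have j3 := i3.const_mul (4 * a)
  have k3 : Integrable (fun x => x ^ 4 + (4 * a) * x ^ 3) (gaussianReal 0 v) := i4.add j3
  have k2 : Integrable (fun x => x ^ 4 + (4 * a) * x ^ 3 + (6 * a ^ 2) * x ^ 2)
    (gaussianReal 0 v) := k3.add j2
  have k1 : Integrable (fun x => x ^ 4 + (4 * a) * x ^ 3 + (6 * a ^ 2) * x ^ 2 + (4 * a ^ 3) * x)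
    (gaussianReal 0 v) := k2.add j1
  rw [integral_add k1 (integrable_const _), integral_add k2 j1, integral_add k3 j2,
    integral_add i4 j3, integral_const_mul, integral_const_mul, integral_const_mul, h1, h2, h3, h4]
  simp
  ring

lemma memLp_add_const_gaussianReal (a : ℝ) (v : ℝ≥0) (p : ℝ≥0) :
    MemLp (fun x => x + a) p (gaussianReal 0 v) :=
  (memLp_id_gaussianReal p).add (memLp_const a)

lemma integral_sum_sq_prod_gaussianReal (a b : ℝ) (v : ℝ≥0) :
    ∫ x, ((x.1 + a) ^ 2 + (x.2 + b) ^ 2) ∂(gaussianReal 0 v).prod (gaussianReal 0 v) =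
      2 * v + (a ^ 2 + b ^ 2) := by
  have i2 (c : ℝ) : Integrable (fun x => (x + c) ^ 2) (gaussianReal 0 v) := by
    exact (memLp_add_const_gaussianReal c v 2).integrable_sq
  rw [integral_add ((i2 a).comp_fst _) ((i2 b).comp_snd _),
    integral_fun_fst (fun x => (x + a) ^ 2), integral_fun_snd (fun x => (x + b) ^ 2),
    integral_add_sq_gaussianReal, integral_add_sq_gaussianReal]
  simp
  ring

lemma integral_sum_sq_sq_prod_gaussianReal (a b : ℝ) (v : ℝ≥0) :
    ∫ x, ((x.1 + a) ^ 2 + (x.2 + b) ^ 2) ^ 2 ∂(gaussianReal 0 v).prod (gaussianReal 0 v) =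
      8 * (v : ℝ) ^ 2 + 8 * v * (a ^ 2 + b ^ 2) + (a ^ 2 + b ^ 2) ^ 2 := by
  have i2 (c : ℝ) : Integrable (fun x => (x + c) ^ 2) (gaussianReal 0 v) := by
    exact (memLp_add_const_gaussianReal c v 2).integrable_sq
  have i4 (c : ℝ) : Integrable (fun x => (x + c) ^ 4) (gaussianReal 0 v) := by
    have := (memLp_add_const_gaussianReal c v 4).integrable_norm_pow (by norm_num)
    refine this.congr (ae_of_all _ fun x => ?_)
    simp [Even.pow_abs (show Even 4 by decide)]
  have : ∀ x : ℝ × ℝ, ((x.1 + a) ^ 2 + (x.2 + b) ^ 2) ^ 2 =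
      (x.1 + a) ^ 4 + 2 * ((x.1 + a) ^ 2 * (x.2 + b) ^ 2) + (x.2 + b) ^ 4 := fun x => by ring
  simp_rw [this]
  have j := (((i2 a).mul_prod (i2 b)).const_mul 2)
  have k : Integrable (fun x : ℝ × ℝ => (x.1 + a) ^ 4 + 2 * ((x.1 + a) ^ 2 * (x.2 + b) ^ 2))
    ((gaussianReal 0 v).prod (gaussianReal 0 v)) := ((i4 a).comp_fst _).add j
  rw [integral_add k ((i4 b).comp_snd _),
    integral_add ((i4 a).comp_fst _) j, integral_const_mul,
    integral_prod_mul (fun x : ℝ => (x + a) ^ 2) (fun x : ℝ => (x + b) ^ 2),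
    integral_fun_fst (fun x => (x + a) ^ 4), integral_fun_snd (fun x => (x + b) ^ 4),
    integral_add_sq_gaussianReal, integral_add_sq_gaussianReal,
    integral_add_pow_four_gaussianReal, integral_add_pow_four_gaussianReal]
  simp
  ring

/-! ### Gamma integrals -/

lemma integral_gammaMeasure_eq {a r : ℝ} (ha : 0 < a) (hr : 0 < r) (f : ℝ → ℝ) :
    ∫ x, f x ∂gammaMeasure a r =
      ∫ x in Set.Ioi 0, (r ^ a / Real.Gamma a * x ^ (a - 1) * Real.exp (-(r * x))) * f x := by
  rw [gammaMeasure, integral_withDensity_eq_integral_toReal_smul₀ (by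
    unfold gammaPDF; fun_prop) (by simp [gammaPDF])]
  have h1 : ∀ x, (gammaPDF a r x).toReal • f x = Set.indicator (Set.Ici 0)
      (fun x => (r ^ a / Real.Gamma a * x ^ (a - 1) * Real.exp (-(r * x))) * f x) x := by
    intro x
    rw [gammaPDF, ENNReal.toReal_ofReal (gammaPDFReal_nonneg ha hr x), gammaPDFReal]
    by_cases hx : 0 ≤ x <;> simp [Set.indicator, hx]
  simp_rw [h1]
  rw [integral_indicator measurableSet_Ici, integral_Ici_eq_integral_Ioi]

lemma ae_nonneg_gammaMeasure (a r : ℝ) : ∀ᵐ x ∂gammaMeasure a r, 0 ≤ x := by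
  rw [ae_iff, gammaMeasure]
  have : {x : ℝ | ¬ 0 ≤ x} = Set.Iio 0 := by ext; simp
  rw [this, withDensity_apply _ measurableSet_Iio, lintegral_gammaPDF_of_nonpos le_rfl]

/-- One formula for two uses: `n = 0` gives the Laplace transform, `c = 0` the moments. -/
lemma integral_pow_mul_exp_gammaMeasure {a r c : ℝ} (ha : 0 < a) (hr : 0 < r) (hc : 0 < r + c)
    (n : ℕ) :
    ∫ x, x ^ n * Real.exp (-c * x) ∂gammaMeasure a r =
      r ^ a / Real.Gamma a * ((1 / (r + c)) ^ (a + n) * Real.Gamma (a + n)) := by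
  rw [integral_gammaMeasure_eq ha hr, ← Real.integral_rpow_mul_exp_neg_mul_Ioi (by positivity) hc,
    ← integral_const_mul]
  refine setIntegral_congr_fun measurableSet_Ioi fun x (hx : 0 < x) => ?_
  have h1 : x ^ (a + n - 1) = x ^ (a - 1) * x ^ n := by
    rw [← Real.rpow_natCast, ← Real.rpow_add hx]; congr 1; ring
  have h2 : Real.exp (-((r + c) * x)) = Real.exp (-(r * x)) * Real.exp (-c * x) := by
    rw [← Real.exp_add]; congr 1; ring
  simp only [h1, h2]
  ring

lemma integral_exp_gammaMeasure {a r c : ℝ} (ha : 0 < a) (hr : 0 < r) (hc : 0 < r + c) :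
    ∫ x, Real.exp (-c * x) ∂gammaMeasure a r = (r / (r + c)) ^ a := by
  have h := integral_pow_mul_exp_gammaMeasure ha hr hc 0
  have hG := (Real.Gamma_pos_of_pos ha).ne'
  simp only [pow_zero, one_mul, Nat.cast_zero, add_zero] at h
  rw [h, div_eq_mul_one_div r, Real.mul_rpow hr.le (by positivity)]
  field_simp

lemma integrable_pow_gammaMeasure {a r : ℝ} (ha : 0 < a) (hr : 0 < r) (n : ℕ) :
    Integrable (fun x => x ^ n) (gammaMeasure a r) := by
  have h := integral_pow_mul_exp_gammaMeasure (c := 0) ha hr (by simpa) n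
  have hG := Real.Gamma_pos_of_pos ha
  have hG' : 0 < Real.Gamma (a + n) := Real.Gamma_pos_of_pos (by positivity)
  -- A non-integrable function has integral 0 by convention, whereas the closed form is positive.
  by_contra hcon
  simp only [neg_zero, zero_mul, Real.exp_zero, mul_one, add_zero] at h
  rw [integral_undef hcon] at h
  have : 0 < r ^ a / Real.Gamma a * ((1 / r) ^ (a + n) * Real.Gamma (a + n)) := by positivity
  exact this.ne h

lemma integral_id_gammaMeasure {a r : ℝ} (ha : 0 < a) (hr : 0 < r) :
    ∫ x, x ∂gammaMeasure a r = a / r := by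
  have h := integral_pow_mul_exp_gammaMeasure (c := 0) ha hr (by simpa) 1
  have hG := (Real.Gamma_pos_of_pos ha).ne'
  have hra := (Real.rpow_pos_of_pos hr a).ne'
  simp only [neg_zero, zero_mul, Real.exp_zero, mul_one, add_zero, pow_one, Nat.cast_one] at h
  rw [h, Real.Gamma_add_one ha.ne', Real.rpow_add (by positivity), Real.rpow_one,
    Real.div_rpow zero_le_one hr.le, Real.one_rpow]
  field_simp

lemma integral_sq_gammaMeasure {a r : ℝ} (ha : 0 < a) (hr : 0 < r) :
    ∫ x, x ^ 2 ∂gammaMeasure a r = a * (a + 1) / r ^ 2 := by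
  have h := integral_pow_mul_exp_gammaMeasure (c := 0) ha hr (by simpa) 2
  have hG := (Real.Gamma_pos_of_pos ha).ne'
  have hra := (Real.rpow_pos_of_pos hr a).ne'
  simp only [neg_zero, zero_mul, Real.exp_zero, mul_one, add_zero, Nat.cast_ofNat] at h
  rw [h, show a + 2 = a + 1 + 1 by ring, Real.Gamma_add_one (by positivity),
    Real.Gamma_add_one ha.ne', Real.rpow_add (by positivity), Real.rpow_add (by positivity),
    Real.rpow_one, Real.div_rpow zero_le_one hr.le, Real.one_rpow]
  field_simp

/-- The derivatives of consecutive terms telescope, and only minus the Erlang density of shape `m +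
1` survives. -/
lemma hasDerivAt_erlang_tail (r : ℝ) (m : ℕ) (x : ℝ) :
    HasDerivAt (fun y => Real.exp (-(r * y)) * ∑ n ∈ Finset.range (m + 1),
        (r * y) ^ n / (n.factorial : ℝ))
      (-(r * (r * x) ^ m / (m.factorial : ℝ) * Real.exp (-(r * x)))) x := by
  have hl : HasDerivAt (fun y : ℝ => r * y) r x := by
    simpa using (hasDerivAt_id x).const_mul r
  have he : HasDerivAt (fun y : ℝ => Real.exp (-(r * y))) (Real.exp (-(r * x)) * -r) x :=
    hl.neg.exp
  induction m with
  | zero => simpa [mul_comm] using he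
  | succ m ih =>
    simp_rw [Finset.sum_range_succ _ (m + 1), mul_add]
    have hp := he.mul ((hl.pow (m + 1)).div_const ((m + 1).factorial : ℝ))
    refine (ih.add hp).congr_deriv ?_
    have : (m.factorial : ℝ) ≠ 0 := by positivity
    rw [Nat.factorial_succ]
    push_cast
    simp only [Pi.pow_apply, pow_succ]
    field_simp
    ring

lemma gammaMeasure_real_Ioi {r y : ℝ} (hr : 0 < r) (hy : 0 ≤ y) (m : ℕ) :
    (gammaMeasure (m + 1 : ℕ) r).real (Set.Ioi y) =
      Real.exp (-(r * y)) * ∑ n ∈ Finset.range (m + 1), (r * y) ^ n / (n.factorial : ℝ) := by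
  have ha : (0 : ℝ) < ((m + 1 : ℕ) : ℝ) := by positivity
  rw [← integral_indicator_one measurableSet_Ioi, integral_gammaMeasure_eq ha hr]
  have h1 : ∀ x : ℝ, r ^ ((m + 1 : ℕ) : ℝ) / Real.Gamma ((m + 1 : ℕ) : ℝ) *
      x ^ (((m + 1 : ℕ) : ℝ) - 1) * Real.exp (-(r * x)) * (Set.Ioi y).indicator 1 x =
      (Set.Ioi y).indicator
        (fun x => r * (r * x) ^ m / (m.factorial : ℝ) * Real.exp (-(r * x))) x := by
    intro x
    by_cases hx : x ∈ Set.Ioi y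
    · simp only [Set.indicator_of_mem hx, Pi.one_apply, mul_one]
      rw [Real.rpow_natCast]
      push_cast
      rw [Real.Gamma_nat_eq_factorial, add_sub_cancel_right, Real.rpow_natCast]
      ring
    · simp [Set.indicator_of_notMem hx]
  simp_rw [h1]
  rw [setIntegral_indicator measurableSet_Ioi, Set.Ioi_inter_Ioi, max_eq_right hy]
  have hlim : Filter.Tendsto (fun x => Real.exp (-(r * x)) * ∑ n ∈ Finset.range (m + 1),
      (r * x) ^ n / (n.factorial : ℝ)) Filter.atTop (nhds 0) := by
    simp_rw [Finset.mul_sum]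
    rw [← Finset.sum_const_zero (s := Finset.range (m + 1))]
    refine tendsto_finsetSum _ fun n _ => ?_
    have h := (Real.tendsto_pow_mul_exp_neg_atTop_nhds_zero n).comp
      (Filter.tendsto_id.const_mul_atTop hr)
    have h2 := h.div_const (n.factorial : ℝ)
    rw [zero_div] at h2
    refine h2.congr fun x => ?_
    simp only [Function.comp, id]
    ring
  -- The constant sign of the derivative makes a separate integrability proof unnecessary.
  have key := integral_Ioi_of_hasDerivAt_of_nonpos' (a := y)
    (fun x _ => hasDerivAt_erlang_tail r m x) (fun x hx => by
      have : 0 < x := lt_of_le_of_lt hy hx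
      simp only [Left.neg_nonpos_iff]
      positivity) hlim
  rw [integral_neg] at key
  linarith

/-! ### Rician law -/

lemma measurable_complex_mk : Measurable fun t : ℝ × ℝ => (⟨t.1, t.2⟩ : ℂ) :=
  Complex.measurableEquivRealProd.symm.measurable

lemma norm_sq_ricianMap {κ : ℝ} (hκ : 0 ≤ κ) (a : ℂ) (x y : ℝ) :
    ‖(((Real.sqrt κ : ℝ) : ℂ) * a + ⟨x, y⟩) / ((Real.sqrt (κ + 1) : ℝ) : ℂ)‖ ^ 2 =
      ((x + Real.sqrt κ * a.re) ^ 2 + (y + Real.sqrt κ * a.im) ^ 2) / (κ + 1) := by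
  rw [norm_div, div_pow, Complex.norm_real, Real.norm_eq_abs, sq_abs,
    Real.sq_sqrt (by positivity), ← Complex.normSq_eq_norm_sq, Complex.normSq_apply]
  simp
  ring

/-- Integrating a function of `‖h‖²` against the Rician law. -/
lemma integral_norm_sq_ricianLaw {κ : ℝ} (hκ : 0 ≤ κ) (a : ℂ) {f : ℝ → ℝ} (hf : Measurable f) :
    ∫ h, f (‖h‖ ^ 2) ∂ricianLaw κ a =
      ∫ x, f (((x.1 + Real.sqrt κ * a.re) ^ 2 + (x.2 + Real.sqrt κ * a.im) ^ 2) / (κ + 1))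
        ∂(gaussianReal 0 (1 / 2)).prod (gaussianReal 0 (1 / 2)) := by
  have hv : ((1 : ℝ) / 2).toNNReal = 1 / 2 := by
    rw [Real.toNNReal_div zero_le_one]; simp
  have m1 : Measurable fun h : ℂ => f (‖h‖ ^ 2) := hf.comp (by fun_prop)
  have m2 : Measurable fun z : ℂ =>
      f (‖(((Real.sqrt κ : ℝ) : ℂ) * a + z) / ((Real.sqrt (κ + 1) : ℝ) : ℂ)‖ ^ 2) :=
    hf.comp (by fun_prop)
  rw [ricianLaw, integral_map (by fun_prop) m1.aestronglyMeasurable, circularGaussian,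
    integral_map measurable_complex_mk.aemeasurable m2.aestronglyMeasurable, hv]
  simp_rw [norm_sq_ricianMap hκ]

lemma sq_add_sq_eq {κ : ℝ} (hκ : 0 ≤ κ) {a : ℂ} (ha : ‖a‖ = 1) :
    (Real.sqrt κ * a.re) ^ 2 + (Real.sqrt κ * a.im) ^ 2 = κ := by
  have h : a.re * a.re + a.im * a.im = 1 := by
    rw [← Complex.normSq_apply, Complex.normSq_eq_norm_sq, ha, one_pow]
  rw [mul_pow, mul_pow, Real.sq_sqrt hκ]
  linear_combination κ * h

lemma integral_exp_ricianLaw {κ : ℝ} (hκ : 0 ≤ κ) {a : ℂ} (ha : ‖a‖ = 1) {γ s : ℝ}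
    (hγ : 0 ≤ γ) (hs : 0 ≤ s) :
    ∫ h, Real.exp (-s * (γ * ‖h‖ ^ 2)) ∂ricianLaw κ a = interfererLaplace γ κ s := by
  rw [integral_norm_sq_ricianLaw hκ a (f := fun u => Real.exp (-s * (γ * u))) (by fun_prop)]
  have h := integral_exp_neg_add_sq_prod_gaussianReal (Real.sqrt κ * a.re) (Real.sqrt κ * a.im)
    (γ / (1 + κ) * s) (by positivity) (v := 1 / 2) (by simp)
  rw [sq_add_sq_eq hκ ha] at h
  have e : ∀ u : ℝ, -s * (γ * (u / (κ + 1))) = -(γ / (1 + κ) * s) * u := fun u => by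
    rw [add_comm κ]; ring
  simp_rw [e, h, interfererLaplace]
  have hD : 0 < 1 + γ / (1 + κ) * s := by positivity
  push_cast
  rw [show 1 + 2 * (1 / 2) * (γ / (1 + κ) * s) = 1 + γ / (1 + κ) * s by ring]
  congr 2
  generalize γ / (1 + κ) * s = t at *
  field_simp
  ring

lemma integral_norm_sq_ricianLaw_eq_one {κ : ℝ} (hκ : 0 ≤ κ) {a : ℂ} (ha : ‖a‖ = 1) :
    ∫ h, ‖h‖ ^ 2 ∂ricianLaw κ a = 1 := by
  rw [integral_norm_sq_ricianLaw hκ a (f := fun u => u) measurable_id, integral_div,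
    integral_sum_sq_prod_gaussianReal, sq_add_sq_eq hκ ha]
  have : κ + 1 ≠ 0 := by positivity
  push_cast
  field_simp
  ring

lemma integral_norm_sq_sq_ricianLaw {κ : ℝ} (hκ : 0 ≤ κ) {a : ℂ} (ha : ‖a‖ = 1) :
    ∫ h, (‖h‖ ^ 2) ^ 2 ∂ricianLaw κ a = 1 + (2 * κ + 1) / (κ + 1) ^ 2 := by
  rw [integral_norm_sq_ricianLaw hκ a (f := fun u => u ^ 2) (by fun_prop)]
  simp_rw [div_pow]
  rw [integral_div, integral_sum_sq_sq_prod_gaussianReal, sq_add_sq_eq hκ ha]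
  have : κ + 1 ≠ 0 := by positivity
  push_cast
  field_simp
  ring

/-- Membership in `L²` follows from a nonzero second moment. -/
lemma memLp_two_of_integral_sq_ne_zero {α : Type*} [MeasurableSpace α] {μ : Measure α} {f : α → ℝ}
    (hf : AEStronglyMeasurable f μ) (h : ∫ x, f x ^ 2 ∂μ ≠ 0) : MemLp f 2 μ := by
  rw [memLp_two_iff_integrable_sq hf]
  by_contra hcon
  exact h (integral_undef hcon)

lemma IsRician.moments {Ω : Type*} [MeasurableSpace Ω] {P : Measure Ω} {κ : ℝ} (hκ : 0 ≤ κ)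
    {h : Ω → ℂ} (hh : IsRician P κ h) :
    MemLp (fun ω => ‖h ω‖ ^ 2) 2 P ∧ ∫ ω, ‖h ω‖ ^ 2 ∂P = 1 ∧
      ∫ ω, (‖h ω‖ ^ 2) ^ 2 ∂P = 1 + (2 * κ + 1) / (κ + 1) ^ 2 := by
  obtain ⟨a, ha, hlaw⟩ := hh
  have h1 := hlaw.integral_comp (f := fun z => ‖z‖ ^ 2) (by fun_prop)
  have h2 := hlaw.integral_comp (f := fun z => (‖z‖ ^ 2) ^ 2) (by fun_prop)
  rw [integral_norm_sq_ricianLaw_eq_one hκ ha] at h1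
  rw [integral_norm_sq_sq_ricianLaw hκ ha] at h2
  refine ⟨memLp_two_of_integral_sq_ne_zero ?_ ?_, h1, h2⟩
  · have := hlaw.aemeasurable
    exact (by fun_prop : AEMeasurable (fun ω => ‖h ω‖ ^ 2) P).aestronglyMeasurable
  · have h3 : ∫ ω, (‖h ω‖ ^ 2) ^ 2 ∂P = _ := h2
    rw [h3]
    positivity

lemma IsRician.aemeasurable {Ω : Type*} [MeasurableSpace Ω] {P : Measure Ω} {κ : ℝ}
    {h : Ω → ℂ} (hh : IsRician P κ h) : AEMeasurable h P := by
  obtain ⟨a, -, hlaw⟩ := hh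
  exact hlaw.aemeasurable

lemma IsRician.mgf_eq {Ω : Type*} [MeasurableSpace Ω] {P : Measure Ω} {κ : ℝ} (hκ : 0 ≤ κ)
    {h : Ω → ℂ} (hh : IsRician P κ h) {γ s : ℝ} (hγ : 0 ≤ γ) (hs : 0 ≤ s) :
    mgf (fun ω => γ * ‖h ω‖ ^ 2) P (-s) = interfererLaplace γ κ s := by
  obtain ⟨a, ha, hlaw⟩ := hh
  rw [← integral_exp_ricianLaw hκ ha hγ hs, mgf,
    ← hlaw.integral_comp (f := fun z => Real.exp (-s * (γ * ‖z‖ ^ 2))) (by fun_prop)]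
  rfl

/-! ### Shadowed Rician law -/

lemma isProbabilityMeasure_nakagamiLaw {ψ w : ℝ} (hψ : 0 < ψ) (hw : 0 < w) :
    IsProbabilityMeasure (nakagamiLaw ψ w) := by
  have := isProbabilityMeasure_gammaMeasure hψ (div_pos hψ hw)
  exact Measure.isProbabilityMeasure_map (by fun_prop)

/-- Integrating a function of `ξ²` against the Nakagami law. -/
lemma integral_sq_nakagamiLaw (ψ w : ℝ) {f : ℝ → ℝ} (hf : Measurable f) :
    ∫ x, f (x ^ 2) ∂nakagamiLaw ψ w = ∫ x, f x ∂gammaMeasure ψ (ψ / w) := by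
  have m1 : Measurable fun x : ℝ => f (x ^ 2) := hf.comp (by fun_prop)
  rw [nakagamiLaw, integral_map (by fun_prop) m1.aestronglyMeasurable]
  refine integral_congr_ae ?_
  filter_upwards [ae_nonneg_gammaMeasure ψ (ψ / w)] with x hx
  rw [Real.sq_sqrt hx]

lemma memLp_four_nakagamiLaw {ψ w : ℝ} (hψ : 0 < ψ) (hw : 0 < w) :
    MemLp (fun x => x) 4 (nakagamiLaw ψ w) := by
  have hr := div_pos hψ hw
  rw [nakagamiLaw, memLp_map_measure_iff (by fun_prop) (by fun_prop),
    ← integrable_norm_rpow_iff (by fun_prop) (by simp) (by simp)]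
  refine (integrable_pow_gammaMeasure hψ hr 2).congr ?_
  filter_upwards [ae_nonneg_gammaMeasure ψ (ψ / w)] with x hx
  have : ((4 : ℝ≥0∞).toReal) = ((4 : ℕ) : ℝ) := by simp
  rw [this, Real.rpow_natCast]
  simp only [Function.comp, Real.norm_eq_abs, abs_of_nonneg (Real.sqrt_nonneg x)]
  rw [show (4 : ℕ) = 2 * 2 by norm_num, pow_mul, Real.sq_sqrt hx]

/-- Regrouping puts the Gaussian pair in one factor, so that Fubini can integrate it out first with
the Nakagami component fixed. -/
lemma shadowedRicianLaw_eq (σ2 ψ w p q : ℝ) (hψ : 0 < ψ) (hw : 0 < w) :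
    shadowedRicianLaw σ2 ψ w p q =
      (((gaussianReal 0 (σ2 / 2).toNNReal).prod (gaussianReal 0 (σ2 / 2).toNNReal)).prod
        (nakagamiLaw ψ w)).map
        (fun t : (ℝ × ℝ) × ℝ => (t.1.1 + t.2 * p) ^ 2 + (t.1.2 + t.2 * q) ^ 2) := by
  have := isProbabilityMeasure_nakagamiLaw hψ hw
  rw [shadowedRicianLaw, ← (measurePreserving_prodAssoc _ _ _).map_eq,
    Measure.map_map (by fun_prop) (by fun_prop)]
  rfl

lemma memLp_two_shadowedRicianLaw (σ2 : ℝ) {ψ w : ℝ} (p q : ℝ) (hψ : 0 < ψ) (hw : 0 < w) :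
    MemLp (fun x => x) 2 (shadowedRicianLaw σ2 ψ w p q) := by
  have := isProbabilityMeasure_nakagamiLaw hψ hw
  rw [shadowedRicianLaw_eq _ _ _ _ _ hψ hw, memLp_map_measure_iff (by fun_prop) (by fun_prop)]
  set v := (σ2 / 2).toNNReal
  have hN : MemLp (fun t : (ℝ × ℝ) × ℝ => t.2) 4
      (((gaussianReal 0 v).prod (gaussianReal 0 v)).prod (nakagamiLaw ψ w)) :=
    (memLp_four_nakagamiLaw hψ hw).comp_snd _
  have hG : MemLp (fun x => x) 4 (gaussianReal 0 v) := memLp_id_gaussianReal' 4 (by simp)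
  have hA : MemLp (fun t : (ℝ × ℝ) × ℝ => t.1.1) 4
      (((gaussianReal 0 v).prod (gaussianReal 0 v)).prod (nakagamiLaw ψ w)) :=
    (hG.comp_fst (gaussianReal 0 v)).comp_fst _
  have hB : MemLp (fun t : (ℝ × ℝ) × ℝ => t.1.2) 4
      (((gaussianReal 0 v).prod (gaussianReal 0 v)).prod (nakagamiLaw ψ w)) :=
    (hG.comp_snd (gaussianReal 0 v)).comp_fst _
  -- Since `1/4 + 1/4 = 1/2`, squares of `L⁴` functions lie in `L²`.
  have : ENNReal.HolderTriple 4 4 2 := ⟨by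
    rw [← ENNReal.toReal_eq_toReal_iff' (by simp) (by simp), ENNReal.toReal_add (by simp) (by simp)]
    simp
    norm_num⟩
  have hsq {f : (ℝ × ℝ) × ℝ → ℝ} (hf : MemLp f 4
      (((gaussianReal 0 v).prod (gaussianReal 0 v)).prod (nakagamiLaw ψ w))) :
      MemLp (fun t => f t ^ 2) 2
        (((gaussianReal 0 v).prod (gaussianReal 0 v)).prod (nakagamiLaw ψ w)) := by
    simp_rw [pow_two]
    exact hf.mul' hf
  exact (hsq (hA.add (hN.mul_const p))).add (hsq (hB.add (hN.mul_const q)))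

/-- Integration against the shadowed Rician law, conditioning on the Nakagami component. -/
lemma integral_shadowedRicianLaw {σ2 ψ w p q : ℝ} (hψ : 0 < ψ) (hw : 0 < w)
    {f : ℝ → ℝ} (hf : Measurable f) (hi : Integrable f (shadowedRicianLaw σ2 ψ w p q)) :
    ∫ x, f x ∂shadowedRicianLaw σ2 ψ w p q =
      ∫ y, ∫ x, f ((x.1 + y * p) ^ 2 + (x.2 + y * q) ^ 2)
        ∂(gaussianReal 0 (σ2 / 2).toNNReal).prod (gaussianReal 0 (σ2 / 2).toNNReal)
        ∂nakagamiLaw ψ w := by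
  have := isProbabilityMeasure_nakagamiLaw hψ hw
  rw [shadowedRicianLaw_eq _ _ _ _ _ hψ hw] at hi ⊢
  rw [integral_map (by fun_prop) hf.aestronglyMeasurable, integral_prod_symm]
  exact (integrable_map_measure hf.aestronglyMeasurable (by fun_prop)).1 hi

lemma mul_sq_add_mul_sq {p q : ℝ} (h : p ^ 2 + q ^ 2 = 1) (y : ℝ) :
    (y * p) ^ 2 + (y * q) ^ 2 = y ^ 2 := by
  linear_combination y ^ 2 * h

lemma isProbabilityMeasure_shadowedRicianLaw (σ2 : ℝ) {ψ w : ℝ} (p q : ℝ) (hψ : 0 < ψ)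
    (hw : 0 < w) : IsProbabilityMeasure (shadowedRicianLaw σ2 ψ w p q) := by
  have := isProbabilityMeasure_nakagamiLaw hψ hw
  exact Measure.isProbabilityMeasure_map (by fun_prop)

lemma integral_id_shadowedRicianLaw {σ2 ψ w p q : ℝ} (hσ : 0 ≤ σ2) (hψ : 0 < ψ) (hw : 0 < w)
    (hpq : p ^ 2 + q ^ 2 = 1) :
    ∫ x, x ∂shadowedRicianLaw σ2 ψ w p q = σ2 + w := by
  have := isProbabilityMeasure_shadowedRicianLaw σ2 p q hψ hw
  have hN := isProbabilityMeasure_nakagamiLaw hψ hw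
  have hv : ((σ2 / 2).toNNReal : ℝ) = σ2 / 2 := Real.coe_toNNReal _ (by positivity)
  have hr := div_pos hψ hw
  have hi : Integrable (fun x => x ^ 2) (nakagamiLaw ψ w) :=
    ((memLp_four_nakagamiLaw hψ hw).mono_exponent (by norm_num)).integrable_sq
  rw [integral_shadowedRicianLaw hψ hw (f := fun x => x) measurable_id
    ((memLp_two_shadowedRicianLaw σ2 p q hψ hw).integrable one_le_two)]
  simp_rw [integral_sum_sq_prod_gaussianReal, mul_sq_add_mul_sq hpq, hv]
  rw [integral_add (integrable_const _) hi,
    integral_sq_nakagamiLaw ψ w (f := fun x => x) measurable_id, integral_id_gammaMeasure hψ hr]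
  simp
  field_simp

lemma integral_sq_shadowedRicianLaw {σ2 ψ w p q : ℝ} (hσ : 0 ≤ σ2) (hψ : 0 < ψ) (hw : 0 < w)
    (hpq : p ^ 2 + q ^ 2 = 1) :
    ∫ x, x ^ 2 ∂shadowedRicianLaw σ2 ψ w p q =
      2 * σ2 ^ 2 + 4 * σ2 * w + w ^ 2 * (ψ + 1) / ψ := by
  have := isProbabilityMeasure_shadowedRicianLaw σ2 p q hψ hw
  have hN := isProbabilityMeasure_nakagamiLaw hψ hw
  have hv : ((σ2 / 2).toNNReal : ℝ) = σ2 / 2 := Real.coe_toNNReal _ (by positivity)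
  have hr := div_pos hψ hw
  have hi : Integrable (fun x => x ^ 2) (nakagamiLaw ψ w) :=
    ((memLp_four_nakagamiLaw hψ hw).mono_exponent (by norm_num)).integrable_sq
  have hi4 : Integrable (fun x => (x ^ 2) ^ 2) (nakagamiLaw ψ w) := by
    refine ((memLp_four_nakagamiLaw hψ hw).integrable_norm_pow (by norm_num)).congr
      (ae_of_all _ fun x => ?_)
    simp [Even.pow_abs (show Even 4 by decide), ← pow_mul]
  rw [integral_shadowedRicianLaw hψ hw (f := fun x => x ^ 2) (by fun_prop)
    (memLp_two_shadowedRicianLaw σ2 p q hψ hw).integrable_sq]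
  simp_rw [integral_sum_sq_sq_prod_gaussianReal, mul_sq_add_mul_sq hpq, hv]
  have j : Integrable (fun x : ℝ => 8 * (σ2 / 2) ^ 2 + 8 * (σ2 / 2) * x ^ 2) (nakagamiLaw ψ w) :=
    (integrable_const _).add (hi.const_mul _)
  rw [integral_add j hi4, integral_add (integrable_const _) (hi.const_mul _), integral_const,
    integral_const_mul, integral_sq_nakagamiLaw ψ w (f := fun x => x) measurable_id,
    integral_id_gammaMeasure hψ hr, integral_sq_nakagamiLaw ψ w (f := fun x => x ^ 2) (by fun_prop),
    integral_sq_gammaMeasure hψ hr]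
  simp
  field_simp
  ring

lemma ae_nonneg_shadowedRicianLaw (σ2 ψ w p q : ℝ) :
    ∀ᵐ x ∂shadowedRicianLaw σ2 ψ w p q, 0 ≤ x := by
  rw [shadowedRicianLaw, ae_map_iff (by fun_prop) measurableSet_Ici]
  exact ae_of_all _ fun t => by positivity

/-- The inner Gaussian integral depends on the Nakagami variable only through its square, a Gamma
variable, whose transform is then taken at `t / (1 + σ² t)`. -/
lemma integral_exp_shadowedRicianLaw {σ2 ψ w p q t : ℝ} (hσ : 0 < σ2) (hψ : 0 < ψ) (hw : 0 < w)
    (hpq : p ^ 2 + q ^ 2 = 1) (ht : 0 ≤ t) :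
    ∫ x, Real.exp (-t * x) ∂shadowedRicianLaw σ2 ψ w p q =
      ((1 + σ2 * t) / (1 + (σ2 + w / ψ) * t)) ^ ψ / (1 + σ2 * t) := by
  have := isProbabilityMeasure_shadowedRicianLaw σ2 p q hψ hw
  have hv : ((σ2 / 2).toNNReal : ℝ) = σ2 / 2 := Real.coe_toNNReal _ (by positivity)
  have hv0 : (σ2 / 2).toNNReal ≠ 0 := by simpa using hσ
  have hr := div_pos hψ hw
  have hD : 0 < 1 + σ2 * t := by positivity
  have hi : Integrable (fun x => Real.exp (-t * x)) (shadowedRicianLaw σ2 ψ w p q) := by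
    refine Integrable.of_bound (C := 1) (by fun_prop) ?_
    filter_upwards [ae_nonneg_shadowedRicianLaw σ2 ψ w p q] with x hx
    rw [Real.norm_eq_abs, Real.abs_exp, Real.exp_le_one_iff]
    nlinarith [mul_nonneg ht hx]
  rw [integral_shadowedRicianLaw hψ hw (f := fun x => Real.exp (-t * x)) (by fun_prop) hi]
  simp_rw [integral_exp_neg_add_sq_prod_gaussianReal _ _ t ht hv0, mul_sq_add_mul_sq hpq, hv]
  rw [show 1 + 2 * (σ2 / 2) * t = 1 + σ2 * t by ring, integral_div]
  rw [integral_sq_nakagamiLaw ψ w (f := fun x => Real.exp (-(x * t) / (1 + σ2 * t)))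
    (by fun_prop)]
  have e : ∀ x : ℝ, -(x * t) / (1 + σ2 * t) = -(t / (1 + σ2 * t)) * x := fun x => by ring
  simp_rw [e]
  rw [integral_exp_gammaMeasure hψ hr (by positivity)]
  congr 2
  field_simp
  ring

/-! ### Uniqueness of Laplace transforms -/

/-- The exponential series is integrated termwise, dominated by `|t|^n / n!`. -/
lemma hasSum_mgf_id_of_bounded {μ : Measure ℝ} [IsFiniteMeasure μ] (hμ : ∀ᵐ x ∂μ, |x| ≤ 1)
    (t : ℝ) :
    HasSum (fun n : ℕ => t ^ n / (n.factorial : ℝ) * ∫ x, x ^ n ∂μ) (mgf id μ t) := by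
  simp_rw [← integral_const_mul]
  refine hasSum_integral_of_dominated_convergence
    (fun n _ => |t| ^ n / (n.factorial : ℝ)) (fun n => by fun_prop) (fun n => ?_) ?_ ?_ ?_
  · filter_upwards [hμ] with x hx
    rw [norm_mul, norm_div, norm_pow, norm_pow, Real.norm_natCast, Real.norm_eq_abs,
      Real.norm_eq_abs]
    exact mul_le_of_le_one_right (by positivity) (pow_le_one₀ (abs_nonneg x) hx)
  · exact ae_of_all _ fun _ => Real.summable_pow_div_factorial |t|
  · exact integrable_const _
  · refine ae_of_all _ fun x => ?_
    have h := NormedSpace.expSeries_div_hasSum_exp (𝔸 := ℝ) (t * x)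
    rw [← Real.exp_eq_exp_ℝ] at h
    refine h.congr_fun fun n => ?_
    rw [mul_pow]
    ring

/-- Measures on `[-1, 1]` are determined by their moments. -/
lemma ext_of_integral_pow_eq {μ ν : Measure ℝ} [IsProbabilityMeasure μ] [IsFiniteMeasure ν]
    (hμ : ∀ᵐ x ∂μ, |x| ≤ 1) (hν : ∀ᵐ x ∂ν, |x| ≤ 1)
    (h : ∀ n : ℕ, ∫ x, x ^ n ∂μ = ∫ x, x ^ n ∂ν) : μ = ν := by
  have hm : mgf id μ = mgf id ν := by
    ext t
    have h1 := hasSum_mgf_id_of_bounded hμ t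
    simp_rw [h] at h1
    exact h1.unique (hasSum_mgf_id_of_bounded hν t)
  -- Exponential integrability at every real `t` lets the equality of the real transforms extend to
  -- the whole complex plane.
  have hset : integrableExpSet id μ = Set.univ := by
    refine Set.eq_univ_of_forall fun t => ?_
    refine Integrable.of_bound (C := Real.exp |t|) (by fun_prop) ?_
    filter_upwards [hμ] with x hx
    rw [Real.norm_eq_abs, Real.abs_exp, Real.exp_le_exp]
    refine (le_abs_self _).trans ?_
    rw [abs_mul]
    exact mul_le_of_le_one_right (abs_nonneg t) hx
  refine Measure.ext_of_complexMGF_id_eq (funext fun z => ?_)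
  exact eqOn_complexMGF_of_mgf hm (by simp [hset])

/-- Measures on `[0, ∞)` are determined by their Laplace transforms. -/
lemma ext_of_laplace_eq {μ ν : Measure ℝ} [IsProbabilityMeasure μ] [IsFiniteMeasure ν]
    (hμ : ∀ᵐ x ∂μ, 0 ≤ x) (hν : ∀ᵐ x ∂ν, 0 ≤ x)
    (h : ∀ t : ℝ, 0 ≤ t → ∫ x, Real.exp (-t * x) ∂μ = ∫ x, Real.exp (-t * x) ∂ν) : μ = ν := by
  have hme : Measurable fun x : ℝ => Real.exp (-x) := by fun_prop
  -- The change of variable `x ↦ e^{-x}` maps `[0, ∞)` into `[0, 1]` and is inverted by `-log`; the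
  -- `n`-th moment of the image is the Laplace transform at `n`.
  have hinv (ρ : Measure ℝ) :
      (ρ.map fun x => Real.exp (-x)).map (fun y => -Real.log y) = ρ := by
    rw [Measure.map_map (by fun_prop) hme]
    convert! Measure.map_id
    ext x
    simp
  have hbd {ρ : Measure ℝ} (hρ : ∀ᵐ x ∂ρ, 0 ≤ x) :
      ∀ᵐ y ∂(ρ.map fun x => Real.exp (-x)), |y| ≤ 1 := by
    rw [ae_map_iff hme.aemeasurable (measurableSet_le (by fun_prop) (by fun_prop))]
    filter_upwards [hρ] with x hx
    simpa using hx
  have : IsProbabilityMeasure (μ.map fun x => Real.exp (-x)) :=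
    Measure.isProbabilityMeasure_map hme.aemeasurable
  have key : (μ.map fun x => Real.exp (-x)) = ν.map fun x => Real.exp (-x) := by
    refine ext_of_integral_pow_eq (hbd hμ) (hbd hν) fun n => ?_
    rw [integral_map hme.aemeasurable (by fun_prop), integral_map hme.aemeasurable (by fun_prop)]
    have e : ∀ x : ℝ, Real.exp (-x) ^ n = Real.exp (-(n : ℝ) * x) := fun x => by
      rw [← Real.exp_nat_mul]; congr 1; ring
    simp_rw [e]
    exact h n (Nat.cast_nonneg n)
  rw [← hinv μ, key, hinv ν]

/-! ### Sums over partitions -/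

section Derivatives

open scoped ContDiff

/-- The weight `∏ᵢ xᵢ^{νᵢ} / νᵢ!` of a multiset in which `i` has multiplicity `νᵢ`. -/
def multisetWeight (x : ℕ → ℝ) (s : Multiset ℕ) : ℝ :=
  ∏ i ∈ s.toFinset, x i ^ s.count i / ((s.count i).factorial : ℝ)

lemma multisetWeight_eq_prod {x : ℕ → ℝ} {s : Multiset ℕ} {T : Finset ℕ} (h : s.toFinset ⊆ T) :
    multisetWeight x s = ∏ i ∈ T, x i ^ s.count i / ((s.count i).factorial : ℝ) := by
  refine Finset.prod_subset h fun i _ hi => ?_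
  rw [Multiset.mem_toFinset] at hi
  simp [Multiset.count_eq_zero_of_notMem hi]

/-- Only the factor at `j` changes, and `(ν + 1) · x^(ν+1) / (ν + 1)! = x · x^ν / ν!`. -/
lemma multisetWeight_cons (x : ℕ → ℝ) (s : Multiset ℕ) (j : ℕ) :
    ((j ::ₘ s).count j : ℝ) * multisetWeight x (j ::ₘ s) = x j * multisetWeight x s := by
  have h1 : (j ::ₘ s).toFinset ⊆ insert j s.toFinset := by simp
  have h2 : s.toFinset ⊆ insert j s.toFinset := Finset.subset_insert _ _
  have hj : j ∈ insert j s.toFinset := Finset.mem_insert_self _ _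
  rw [multisetWeight_eq_prod h1, multisetWeight_eq_prod h2, ← Finset.mul_prod_erase _ _ hj,
    ← Finset.mul_prod_erase _ _ hj, ← mul_assoc, ← mul_assoc]
  congr 1
  · have : ((s.count j).factorial : ℝ) ≠ 0 := by positivity
    rw [Multiset.count_cons_self, Nat.factorial_succ, pow_succ]
    push_cast
    field_simp
  · refine Finset.prod_congr rfl fun i hi => ?_
    rw [Multiset.count_cons_of_ne (Finset.ne_of_mem_erase hi)]

/-- The sum of the weights of all partitions of `n`. -/
def partitionSum (x : ℕ → ℝ) (n : ℕ) : ℝ := ∑ p : n.Partition, multisetWeight x p.parts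

lemma partitionSum_zero (x : ℕ → ℝ) : partitionSum x 0 = 1 := by
  simp [partitionSum, multisetWeight]

/-- Partitions without the part `j` contribute 0; removing one `j` matches the others with the
partitions of `n - j`. -/
lemma sum_count_mul_multisetWeight (x : ℕ → ℝ) {n j : ℕ} (hj : 1 ≤ j) (hjn : j ≤ n) :
    ∑ p : n.Partition, (p.parts.count j : ℝ) * multisetWeight x p.parts =
      x j * partitionSum x (n - j) := by
  classical
  have h1 : ∑ p : n.Partition, (p.parts.count j : ℝ) * multisetWeight x p.parts =
      ∑ p : {p : n.Partition // j ∈ p.parts},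
        (p.1.parts.count j : ℝ) * multisetWeight x p.1.parts := by
    rw [← Finset.sum_subtype (Finset.univ.filter fun p : n.Partition => j ∈ p.parts) (by simp)
      (fun p => (p.parts.count j : ℝ) * multisetWeight x p.parts)]
    refine (Finset.sum_subset (Finset.filter_subset _ _) fun p _ hp => ?_).symm
    simp only [Finset.mem_filter, Finset.mem_univ, true_and] at hp
    simp [Multiset.count_eq_zero_of_notMem hp]
  rw [h1, partitionSum, Finset.mul_sum,
    ← (Nat.Partition.partitionWithPartEquiv hj hjn).symm.sum_comp]
  refine Finset.sum_congr rfl fun q _ => ?_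
  rw [Nat.Partition.partitionWithPartEquiv_symm_apply_parts, multisetWeight_cons]

lemma natCast_eq_sum_count {n : ℕ} (p : n.Partition) :
    (n : ℝ) = ∑ k ∈ Finset.range n, ((k + 1 : ℕ) : ℝ) * (p.parts.count (k + 1) : ℝ) := by
  have h1 : p.parts.sum = ∑ j ∈ Finset.Ico 1 (n + 1), p.parts.count j * j := by
    rw [Finset.sum_multiset_count]
    simp only [smul_eq_mul]
    refine Finset.sum_subset (fun i hi => ?_) fun i _ hi => ?_
    · rw [Multiset.mem_toFinset] at hi
      have := p.parts_pos hi
      have := Nat.Partition.le_of_mem_parts hi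
      rw [Finset.mem_Ico]
      omega
    · rw [Multiset.mem_toFinset] at hi
      simp [Multiset.count_eq_zero_of_notMem hi]
  rw [p.parts_sum, Finset.sum_Ico_eq_sum_range] at h1
  conv_lhs => rw [h1]
  push_cast
  refine Finset.sum_congr (by simp) fun k _ => ?_
  rw [add_comm 1 k]
  ring

/-- Each partition of `n + 1` satisfies `n + 1 = ∑ j ν_j`; exchange the sums. This is the
coefficient form of `F' = (∑ j x_j z^(j-1)) F` for `F = exp(∑ x_j z^j)`. -/
lemma succ_mul_partitionSum (x : ℕ → ℝ) (n : ℕ) :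
    ((n + 1 : ℕ) : ℝ) * partitionSum x (n + 1) =
      ∑ k ∈ Finset.range (n + 1), ((k + 1 : ℕ) : ℝ) * x (k + 1) * partitionSum x (n - k) := by
  have h : ((n + 1 : ℕ) : ℝ) * partitionSum x (n + 1) =
      ∑ p : (n + 1).Partition, ∑ k ∈ Finset.range (n + 1),
        ((k + 1 : ℕ) : ℝ) * ((p.parts.count (k + 1) : ℝ) * multisetWeight x p.parts) := by
    rw [partitionSum, Finset.mul_sum]
    refine Finset.sum_congr rfl fun p _ => ?_
    conv_lhs => rw [natCast_eq_sum_count p, Finset.sum_mul]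
    simp_rw [mul_assoc]
  rw [h, Finset.sum_comm]
  refine Finset.sum_congr rfl fun k hk => ?_
  rw [Finset.mem_range] at hk
  rw [← Finset.mul_sum, sum_count_mul_multisetWeight x (by omega) (by omega), mul_assoc,
    Nat.add_sub_add_right]

/-- The recurrence of the complete exponential Bell polynomials. -/
lemma factorial_mul_partitionSum_succ (S : ℕ → ℝ) (n : ℕ) :
    ((n + 1).factorial : ℝ) * partitionSum (fun i => S i / (i.factorial : ℝ)) (n + 1) =
      ∑ k ∈ Finset.range (n + 1), (n.choose k : ℝ) * S (k + 1) *
        (((n - k).factorial : ℝ) * partitionSum (fun i => S i / (i.factorial : ℝ)) (n - k)) := by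
  have h := succ_mul_partitionSum (fun i => S i / (i.factorial : ℝ)) n
  rw [Nat.factorial_succ, Nat.cast_mul, mul_comm ((n + 1 : ℕ) : ℝ), mul_assoc, h, Finset.mul_sum]
  refine Finset.sum_congr rfl fun k hk => ?_
  rw [Finset.mem_range, Nat.lt_succ_iff] at hk
  have hf := Nat.choose_mul_factorial_mul_factorial hk
  have hf' : (n.choose k : ℝ) * k.factorial * (n - k).factorial = n.factorial := by
    exact_mod_cast hf
  rw [← hf', Nat.factorial_succ]
  have : (k.factorial : ℝ) ≠ 0 := by positivity
  push_cast
  field_simp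

lemma iteratedDeriv_eq_of_hasDerivAt_succ {U : Set ℝ} (hU : IsOpen U) {S : ℕ → ℝ → ℝ}
    (hS : ∀ i, 1 ≤ i → ∀ t ∈ U, HasDerivAt (S i) (S (i + 1) t) t) (k : ℕ) :
    ∀ t ∈ U, iteratedDeriv k (S 1) t = S (k + 1) t := by
  induction k with
  | zero => simp
  | succ k ih =>
    intro t ht
    rw [iteratedDeriv_succ]
    have he : iteratedDeriv k (S 1) =ᶠ[𝓝 t] S (k + 1) := by
      filter_upwards [hU.mem_nhds ht] with u hu using ih u hu
    rw [he.deriv_eq]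
    exact (hS (k + 1) (by omega) t ht).deriv

/-- The derivatives of a function `f` with `f' = S₁ f` and `Sᵢ' = Sᵢ₊₁`, as sums over partitions
(Faà di Bruno's formula for an exponential). -/
lemma iteratedDeriv_eq_mul_partitionSum {U : Set ℝ} (hU : IsOpen U) {f : ℝ → ℝ} {S : ℕ → ℝ → ℝ}
    (hS : ∀ i, 1 ≤ i → ∀ t ∈ U, HasDerivAt (S i) (S (i + 1) t) t)
    (hf : ∀ t ∈ U, HasDerivAt f (S 1 t * f t) t)
    (hSc : ∀ t ∈ U, ContDiffAt ℝ ∞ (S 1) t) (hfc : ∀ t ∈ U, ContDiffAt ℝ ∞ f t)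
    {t : ℝ} (ht : t ∈ U) (n : ℕ) :
    iteratedDeriv n f t =
      f t * (n.factorial * partitionSum (fun i => S i t / (i.factorial : ℝ)) n) := by
  induction n using Nat.strong_induction_on with
  | _ n ih =>
    rcases n with _ | n
    · simp [partitionSum_zero]
    · have he : deriv f =ᶠ[𝓝 t] fun u => S 1 u * f u := by
        filter_upwards [hU.mem_nhds ht] with u hu using (hf u hu).deriv
      -- Leibniz' rule applied to `S₁ f` involves all lower derivatives of `f`, hence the strong
      -- induction, and reproduces the Bell recurrence.
      rw [iteratedDeriv_succ', he.iteratedDeriv_eq, iteratedDeriv_fun_mul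
        ((hSc t ht).of_le (by exact_mod_cast le_top)) ((hfc t ht).of_le (by exact_mod_cast le_top)),
        factorial_mul_partitionSum_succ, Finset.mul_sum]
      refine Finset.sum_congr rfl fun k hk => ?_
      rw [ih (n - k) (by omega), iteratedDeriv_eq_of_hasDerivAt_succ hU hS k t ht]
      ring

/-! ### Derivatives of the interference transform -/

lemma hasDerivAt_one_add_mul (b t : ℝ) : HasDerivAt (fun u => 1 + b * u) b t := by
  simpa using ((hasDerivAt_id t).const_mul b).const_add 1

lemma hasDerivAt_interfererLaplace {γ κ t : ℝ} (h : 1 + γ / (1 + κ) * t ≠ 0) :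
    HasDerivAt (interfererLaplace γ κ) (smallDelta γ κ 1 t * interfererLaplace γ κ t) t := by
  unfold interfererLaplace smallDelta
  generalize γ / (1 + κ) = b at *
  have hD := hasDerivAt_one_add_mul b t
  have hE := ((((hasDerivAt_const t κ).div hD h).const_add (-κ)).exp).div hD h
  refine hE.congr_deriv ?_
  simp only [Pi.div_apply]
  field_simp
  simp
  ring

lemma hasDerivAt_smallDelta {γ κ t : ℝ} (h : 1 + γ / (1 + κ) * t ≠ 0) {i : ℕ} (hi : 1 ≤ i) :
    HasDerivAt (smallDelta γ κ i) (smallDelta γ κ (i + 1) t) t := by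
  -- The shift removes the truncated subtraction in `(i - 1)!`.
  obtain ⟨i, rfl⟩ := Nat.exists_eq_add_of_le' hi
  unfold smallDelta
  generalize γ / (1 + κ) = b at *
  have hD := hasDerivAt_one_add_mul b t
  have hE := (((hasDerivAt_const t ((-b) ^ (i + 1))).div (hD.pow (i + 1))
    (pow_ne_zero _ h)).const_mul (i.factorial : ℝ)).mul
    (((hasDerivAt_const t (((i + 1 : ℕ) : ℝ) * κ)).div hD h).const_add 1)
  refine hE.congr_deriv ?_
  simp only [Pi.div_apply, Pi.pow_apply, Nat.add_sub_cancel, Nat.factorial_succ]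
  push_cast
  simp only [pow_succ]
  field_simp
  ring

lemma contDiffAt_one_add_mul (b t : ℝ) : ContDiffAt ℝ ∞ (fun u => 1 + b * u) t :=
  contDiffAt_const.add (contDiffAt_const.mul contDiffAt_id)

lemma contDiffAt_interfererLaplace {γ κ t : ℝ} (h : 1 + γ / (1 + κ) * t ≠ 0) :
    ContDiffAt ℝ ∞ (interfererLaplace γ κ) t :=
  (contDiffAt_const.add (contDiffAt_const.div (contDiffAt_one_add_mul _ t) h)).exp.div
    (contDiffAt_one_add_mul _ t) h

lemma contDiffAt_smallDelta {γ κ t : ℝ} (h : 1 + γ / (1 + κ) * t ≠ 0) (i : ℕ) :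
    ContDiffAt ℝ ∞ (smallDelta γ κ i) t :=
  (contDiffAt_const.mul (contDiffAt_const.div ((contDiffAt_one_add_mul _ t).pow i)
    (pow_ne_zero _ h))).mul
    (contDiffAt_const.add (contDiffAt_const.div (contDiffAt_one_add_mul _ t) h))

/-- Logarithmic derivatives add up; the form `d i * g i t` avoids dividing by `g i t`. -/
lemma hasDerivAt_prod_of_logDeriv {ι : Type*} (s : Finset ι) {g : ι → ℝ → ℝ} {d : ι → ℝ} {t : ℝ}
    (h : ∀ i, HasDerivAt (g i) (d i * g i t) t) :
    HasDerivAt (fun u => ∏ i ∈ s, g i u) ((∑ i ∈ s, d i) * ∏ i ∈ s, g i t) t := by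
  classical
  induction s using Finset.induction_on with
  | empty => simpa using hasDerivAt_const t (1 : ℝ)
  | insert i s hi ih =>
    simp_rw [Finset.prod_insert hi, Finset.sum_insert hi]
    refine ((h i).mul ih).congr_deriv ?_
    ring

section Interference

variable {L K : ℕ} (γI κI : Fin L → ℝ) (γJ κJ : Fin K → ℝ)

/-- The function whose derivatives are `Δ⁽ⁿ⁾`. -/
def deltaZero (t : ℝ) : ℝ :=
  Real.exp (-t) * (∏ l, interfererLaplace (γI l) (κI l) t) *
    ∏ k, interfererLaplace (γJ k) (κJ k) t

/-- The points at which no factor of `deltaZero` is singular. -/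
def regularSet : Set ℝ :=
  {t | (∀ l, 1 + γI l / (1 + κI l) * t ≠ 0) ∧ ∀ k, 1 + γJ k / (1 + κJ k) * t ≠ 0}

/-- Iterated derivatives at `s = 0` are two-sided, so the differential relations must hold on a full
neighbourhood. -/
lemma isOpen_regularSet : IsOpen (regularSet γI κI γJ κJ) := by
  have h (b : ℝ) : IsOpen {t : ℝ | 1 + b * t ≠ 0} :=
    isOpen_ne_fun (by fun_prop) continuous_const
  have e : regularSet γI κI γJ κJ =
      (⋂ l, {t : ℝ | 1 + γI l / (1 + κI l) * t ≠ 0}) ∩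
        ⋂ k, {t : ℝ | 1 + γJ k / (1 + κJ k) * t ≠ 0} := by
    ext t; simp [regularSet]
  rw [e]
  exact (isOpen_iInter_of_finite fun l => h _).inter (isOpen_iInter_of_finite fun k => h _)

variable {γI κI γJ κJ}

lemma mem_regularSet_of_nonneg (hγI : ∀ l, 0 ≤ γI l) (hκI : ∀ l, 0 ≤ κI l)
    (hγJ : ∀ k, 0 ≤ γJ k) (hκJ : ∀ k, 0 ≤ κJ k) {t : ℝ} (ht : 0 ≤ t) :
    t ∈ regularSet γI κI γJ κJ := by
  refine ⟨fun l => ?_, fun k => ?_⟩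
  · have := hγI l; have := hκI l; positivity
  · have := hγJ k; have := hκJ k; positivity

lemma hasDerivAt_bigS {t : ℝ} (ht : t ∈ regularSet γI κI γJ κJ) {i : ℕ} (hi : 1 ≤ i) :
    HasDerivAt (bigS γI κI γJ κJ i) (bigS γI κI γJ κJ (i + 1) t) t := by
  have h1 := HasDerivAt.fun_sum (u := Finset.univ) fun l _ =>
    hasDerivAt_smallDelta (ht.1 l) hi
  have h2 := HasDerivAt.fun_sum (u := Finset.univ) fun k _ =>
    hasDerivAt_smallDelta (ht.2 k) hi
  refine ((h1.add h2).sub_const (if i = 1 then 1 else 0)).congr_deriv ?_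
  -- The constant `Cᵢ` disappears on differentiation, in agreement with `Cᵢ₊₁ = 0` for `i ≥ 1`.
  rw [bigS, if_neg (by omega), sub_zero]

lemma hasDerivAt_deltaZero {t : ℝ} (ht : t ∈ regularSet γI κI γJ κJ) :
    HasDerivAt (deltaZero γI κI γJ κJ) (bigS γI κI γJ κJ 1 t * deltaZero γI κI γJ κJ t) t := by
  have h1 := hasDerivAt_prod_of_logDeriv Finset.univ fun l =>
    hasDerivAt_interfererLaplace (ht.1 l)
  have h2 := hasDerivAt_prod_of_logDeriv Finset.univ fun k =>
    hasDerivAt_interfererLaplace (ht.2 k)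
  have h0 : HasDerivAt (fun u : ℝ => Real.exp (-u)) (Real.exp (-t) * -1) t :=
    (hasDerivAt_neg t).exp
  refine ((h0.mul h1).mul h2).congr_deriv ?_
  simp only [bigS, deltaZero, if_true, Pi.mul_apply]
  ring

lemma contDiffAt_bigS {t : ℝ} (ht : t ∈ regularSet γI κI γJ κJ) (i : ℕ) :
    ContDiffAt ℝ ∞ (bigS γI κI γJ κJ i) t :=
  ((ContDiffAt.sum fun l _ => contDiffAt_smallDelta (ht.1 l) i).add
    (ContDiffAt.sum fun k _ => contDiffAt_smallDelta (ht.2 k) i)).sub contDiffAt_const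

lemma contDiffAt_deltaZero {t : ℝ} (ht : t ∈ regularSet γI κI γJ κJ) :
    ContDiffAt ℝ ∞ (deltaZero γI κI γJ κJ) t :=
  (contDiffAt_id.neg.exp.mul
    (contDiffAt_prod fun l _ => contDiffAt_interfererLaplace (ht.1 l))).mul
    (contDiffAt_prod fun k _ => contDiffAt_interfererLaplace (ht.2 k))

lemma delta_eq_deltaExpansion {t : ℝ} (ht : t ∈ regularSet γI κI γJ κJ) (n : ℕ) :
    delta γI κI γJ κJ n t = deltaExpansion γI κI γJ κJ n t := by
  have h := iteratedDeriv_eq_mul_partitionSum (isOpen_regularSet γI κI γJ κJ)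
    (f := deltaZero γI κI γJ κJ) (S := bigS γI κI γJ κJ) (fun i hi t ht => hasDerivAt_bigS ht hi)
    (fun t ht => hasDerivAt_deltaZero ht) (fun t ht => contDiffAt_bigS ht 1)
    (fun t ht => contDiffAt_deltaZero ht) ht n
  refine h.trans ?_
  rw [deltaExpansion, partitionSum, Finset.mul_sum]
  congr 1
  refine Finset.sum_congr rfl fun p _ => ?_
  -- The factorials of all the parts multiply to `∏ (i!)^{νᵢ}`, which is absorbed in the powers of
  -- `Sᵢ / i!`.
  rw [multisetWeight, Finset.prod_multiset_map_count, mul_div_assoc, ← Finset.prod_div_distrib]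
  congr 1
  refine Finset.prod_congr rfl fun i _ => ?_
  rw [div_pow, div_right_comm]

end Interference

end Derivatives

/-! ### MRT gain and independence -/

section Gain

/-- The beamformer carries the phase of `g m`, so all terms are nonnegative reals and add
coherently. -/
lemma star_mul_mrtWeight {M : ℕ} (g : Fin M → ℂ) (m : Fin M) :
    star (g m) * mrtWeight g m = ((‖g m‖ ^ 2 / Real.sqrt (∑ j, ‖g j‖ ^ 2) : ℝ) : ℂ) := by
  have h : ((‖g m‖ : ℝ) : ℂ) * Complex.exp (Complex.arg (g m) * Complex.I) = g m :=
    Complex.norm_mul_exp_arg_mul_I (g m)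
  have h2 : star (g m) * g m = ((‖g m‖ ^ 2 : ℝ) : ℂ) := by
    rw [Complex.ofReal_pow, ← Complex.conj_mul']; rfl
  calc star (g m) * mrtWeight g m
      = star (g m) * (((‖g m‖ : ℝ) : ℂ) * Complex.exp (Complex.arg (g m) * Complex.I)) /
          ((Real.sqrt (∑ j, ‖g j‖ ^ 2) : ℝ) : ℂ) := by
        rw [mrtWeight]; push_cast; ring
    _ = _ := by rw [h, h2]; push_cast; rfl

lemma mrtPowerGain_eq {M : ℕ} (g : Fin M → ℂ) : mrtPowerGain g = ∑ m, ‖g m‖ ^ 2 := by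
  have h0 : 0 ≤ ∑ m, ‖g m‖ ^ 2 := Finset.sum_nonneg fun _ _ => by positivity
  rw [mrtPowerGain]
  simp_rw [star_mul_mrtWeight]
  -- The identity `x / √x = √x` also covers the zero channel, where division by 0 gives 0.
  rw [← Complex.ofReal_sum, Complex.norm_real, Real.norm_eq_abs, sq_abs, ← Finset.sum_div,
    Real.div_sqrt, Real.sq_sqrt h0]

lemma norm_channel_sq {ℓ : ℝ} (hℓ : 0 ≤ ℓ) (θ : ℝ) (h : ℂ) :
    ‖channel ℓ θ h‖ ^ 2 = ℓ * ‖h‖ ^ 2 := by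
  rw [channel, norm_mul, norm_mul, Complex.norm_exp_ofReal_mul_I, mul_one, mul_pow,
    Complex.norm_real, Real.norm_eq_abs, sq_abs, Real.sq_sqrt hℓ]

lemma mrtPowerGain_channel_div {M : ℕ} {ℓ : ℝ} (hℓ : 0 < ℓ) (θ : Fin M → ℝ) (h : Fin M → ℂ) :
    mrtPowerGain (fun m => channel ℓ (θ m) (h m)) / ℓ = ∑ m, ‖h m‖ ^ 2 := by
  rw [mrtPowerGain_eq]
  simp_rw [norm_channel_sq hℓ.le]
  rw [← Finset.mul_sum]
  field_simp

end Gain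

section Indep

variable {Ω : Type*} [MeasurableSpace Ω] {P : Measure Ω}

/-- Each term has variance `V` and variances add. It serves both for the MRT gain and for the sum of
the `X i`. -/
lemma moments_sum_of_iIndepFun [IsProbabilityMeasure P] {M : ℕ} {U : Fin M → Ω → ℝ} {V : ℝ}
    (hU : iIndepFun U P) (hL : ∀ i, MemLp (U i) 2 P) (h1 : ∀ i, ∫ ω, U i ω ∂P = 1)
    (h2 : ∀ i, ∫ ω, U i ω ^ 2 ∂P = 1 + V) :
    ∫ ω, ∑ i, U i ω ∂P = M ∧ ∫ ω, (∑ i, U i ω) ^ 2 ∂P = (M : ℝ) ^ 2 + M * V := by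
  have hm : ∫ ω, ∑ i, U i ω ∂P = M := by
    rw [integral_finsetSum _ fun i _ => (hL i).integrable one_le_two]
    simp [h1]
  have hLs : MemLp (∑ i, U i) 2 P := memLp_finsetSum' _ fun i _ => hL i
  have hv := IndepFun.variance_sum (s := Finset.univ) (fun i _ => hL i)
    (fun i _ j _ hij => hU.indepFun hij)
  have hvi : ∀ i, variance (U i) P = V := fun i => by
    rw [variance_eq_sub (hL i)]
    simp only [Pi.pow_apply, h1, h2]
    ring
  rw [variance_eq_sub hLs] at hv
  simp only [hvi, Pi.pow_apply, Finset.sum_apply, hm, Finset.sum_const, Finset.card_univ,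
    Fintype.card_fin, nsmul_eq_mul] at hv
  exact ⟨hm, by linarith⟩

lemma indepFun_sum_inl_sum_inr {α β : Type*} [Fintype α] [Fintype β] {Z : α ⊕ β → Ω → ℝ}
    (hZ : iIndepFun Z P) (hm : ∀ i, AEMeasurable (Z i) P) :
    IndepFun (fun ω => ∑ a, Z (Sum.inl a) ω) (fun ω => ∑ b, Z (Sum.inr b) ω) P := by
  classical
  let S : Finset (α ⊕ β) := Finset.univ.map Function.Embedding.inl
  let T : Finset (α ⊕ β) := Finset.univ.map Function.Embedding.inr
  have hST : Disjoint S T := by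
    rw [Finset.disjoint_left]
    intro x hx hy
    simp only [S, T, Finset.mem_map, Finset.mem_univ, true_and] at hx hy
    obtain ⟨a, rfl⟩ := hx
    obtain ⟨b, hb⟩ := hy
    exact Sum.inr_ne_inl hb
  have h := hZ.indepFun_finset₀ S T hST hm
  exact h.comp (φ := fun f : S → ℝ => ∑ a, f ⟨Sum.inl a, by simp [S]⟩)
    (ψ := fun f : T → ℝ => ∑ b, f ⟨Sum.inr b, by simp [T]⟩) (by fun_prop) (by fun_prop)

lemma measureReal_mul_lt_of_indepFun [IsProbabilityMeasure P] {Y W : Ω → ℝ}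
    (hY : AEMeasurable Y P) (hW : AEMeasurable W P) (h : IndepFun Y W P) (c : ℝ) :
    P.real {ω | c * W ω < Y ω} = ∫ ω, (P.map Y).real (Set.Ioi (c * W ω)) ∂P := by
  have hpY : IsProbabilityMeasure (P.map Y) := Measure.isProbabilityMeasure_map hY
  have hpW : IsProbabilityMeasure (P.map W) := Measure.isProbabilityMeasure_map hW
  have hS : MeasurableSet {z : ℝ × ℝ | c * z.2 < z.1} :=
    measurableSet_lt (by fun_prop) (by fun_prop)
  have h1 : P {ω | c * W ω < Y ω} = (P.map fun ω => (Y ω, W ω)) {z : ℝ × ℝ | c * z.2 < z.1} := by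
    rw [Measure.map_apply_of_aemeasurable (hY.prodMk hW) hS]
    rfl
  have hmeas : Measurable fun w : ℝ => (P.map Y) (Set.Ioi (c * w)) :=
    measurable_measure_prodMk_right (μ := P.map Y) hS
  rw [measureReal_def, h1, (indepFun_iff_map_prod_eq_prod_map_map hY hW).1 h,
    Measure.prod_apply_symm hS]
  rw [← integral_map (f := fun w => (P.map Y).real (Set.Ioi (c * w))) hW
    hmeas.ennreal_toReal.aestronglyMeasurable]
  exact (integral_toReal hmeas.aemeasurable (ae_of_all _ fun w => measure_lt_top _ _)).symm

end Indep

/-! ### Moment-matched parameters and the law of the sum -/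

section Parameters

variable {M : ℕ} {ψ κS μ₁ μ₂ : ℝ}

/-- The radicand is a perfect square, because `1 - (2κ + 1) / (κ + 1)² = (κ / (κ + 1))²`. -/
lemma sisrSpread_eq (hM : 1 ≤ M) (hκ : 0 < κS) (h₁ : μ₁ = M)
    (h₂ : μ₂ = M ^ 2 + M * (2 * κS + 1) / (κS + 1) ^ 2) :
    sisrSpread M ψ μ₁ μ₂ = Real.sqrt ψ / Real.sqrt (ψ - 1) * (κS / (κS + 1)) := by
  have hM0 : (0 : ℝ) < M := by exact_mod_cast hM
  have e : (M : ℝ) ^ 2 * (M + 1) - M * (M ^ 2 + M * (2 * κS + 1) / (κS + 1) ^ 2) =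
      (M * (κS / (κS + 1))) ^ 2 := by
    field_simp
    ring
  rw [sisrSpread, h₁, h₂, e, Real.sqrt_sq (by positivity)]
  field_simp

lemma sisrSigmaSq_eq (hM : 1 ≤ M) (h₁ : μ₁ = M) :
    sisrSigmaSq M ψ μ₁ μ₂ = 1 - sisrSpread M ψ μ₁ μ₂ := by
  have hM0 : (M : ℝ) ≠ 0 := by positivity
  rw [sisrSigmaSq, h₁]
  field_simp

/-- From `σ² + Ω = 1` follow `κ = Ω / σ²`, `κ + 1 = 1 / σ²` and `ω = 1`, so that `ξ = κ / ψ`. -/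
lemma sisrXi_eq (hM : 1 ≤ M) (h₁ : μ₁ = M) (hσ : 0 < sisrSigmaSq M ψ μ₁ μ₂)
    (hw : 0 < sisrSpread M ψ μ₁ μ₂) :
    sisrXi M ψ μ₁ μ₂ = sisrSpread M ψ μ₁ μ₂ / (sisrSigmaSq M ψ μ₁ μ₂ * ψ) := by
  have e := sisrSigmaSq_eq (ψ := ψ) (μ₂ := μ₂) hM h₁
  rw [sisrXi, sisrOmega, sisrKappa, show 1 - sisrSigmaSq M ψ μ₁ μ₂ = sisrSpread M ψ μ₁ μ₂ by
    rw [e]; ring]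
  have e' : sisrSpread M ψ μ₁ μ₂ = 1 - sisrSigmaSq M ψ μ₁ μ₂ := by rw [e]; ring
  generalize sisrSpread M ψ μ₁ μ₂ = w at *
  generalize sisrSigmaSq M ψ μ₁ μ₂ = σ2 at *
  have : w / σ2 + 1 = 1 / σ2 := by field_simp; linarith
  rw [this]
  field_simp

lemma sisrAlpha_eq (hM : 1 ≤ M) (h₁ : μ₁ = M) (hσ : 0 < sisrSigmaSq M ψ μ₁ μ₂)
    (hw : 0 < sisrSpread M ψ μ₁ μ₂) (hψ : 0 < ψ) :
    sisrAlpha M ψ μ₁ μ₂ = sisrSigmaSq M ψ μ₁ μ₂ + sisrSpread M ψ μ₁ μ₂ / ψ := by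
  rw [sisrAlpha, sisrXi_eq hM h₁ hσ hw, sisrKappa]
  field_simp
  ring

end Parameters

section SumLaw

/-- The binomial weights of the Gamma mixture. -/
def mixWeight (M N : ℕ) (ξ : ℝ) (k : ℕ) : ℝ :=
  ((N - M).choose k : ℝ) * (1 / (ξ + 1) ^ k) * (ξ / (ξ + 1)) ^ (N - M - k)

lemma mixWeight_nonneg (M N : ℕ) {ξ : ℝ} (hξ : 0 ≤ ξ) (k : ℕ) : 0 ≤ mixWeight M N ξ k := by
  unfold mixWeight
  positivity

/-- Binomial theorem for `u / (ξ + 1) + ξ / (ξ + 1)`; dividing `u^k` by `u^N` leaves the Erlang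
transform of shape `N - k`. -/
lemma sum_mixWeight_div_pow {M N : ℕ} (hMN : M ≤ N) {ξ u : ℝ} (hξ : 0 ≤ ξ) (hu : u ≠ 0) :
    ∑ k ∈ Finset.range (N - M + 1), mixWeight M N ξ k * (1 / u) ^ (N - k) =
      ((u + ξ) / (ξ + 1)) ^ (N - M) / u ^ N := by
  have h1 : ξ + 1 ≠ 0 := by positivity
  rw [show (u + ξ) / (ξ + 1) = u / (ξ + 1) + ξ / (ξ + 1) by ring, add_pow, Finset.sum_div]
  refine Finset.sum_congr rfl fun k hk => ?_
  rw [Finset.mem_range] at hk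
  have e : u ^ N = u ^ k * u ^ (N - k) := by rw [← pow_add]; congr 1; omega
  rw [mixWeight, e, one_div_pow, div_pow u]
  field_simp

variable {Ω : Type*} [MeasurableSpace Ω] {P : Measure Ω}

/-- A sum of independent shadowed Rician variables is a finite mixture of Gamma variables. -/
lemma map_sum_shadowedRician [IsProbabilityMeasure P] {M N : ℕ} {σ2 ψ w : ℝ}
    (hσ : 0 < σ2) (hψ : 1 < ψ) (hw : 0 < w) (hM : 1 ≤ M) (hN : (N : ℝ) = M * ψ)
    {p q : Fin M → ℝ} (hpq : ∀ i, p i ^ 2 + q i ^ 2 = 1) {X : Fin M → Ω → ℝ}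
    (hX : ∀ i, HasLaw (X i) (shadowedRicianLaw σ2 ψ w (p i) (q i)) P) (hind : iIndepFun X P) :
    P.map (fun ω => ∑ i, X i ω) = ∑ k ∈ Finset.range (N - M + 1),
      ENNReal.ofReal (mixWeight M N (w / (σ2 * ψ)) k) •
        gammaMeasure (N - k : ℕ) (1 / (σ2 + w / ψ)) := by
  have hψ0 : 0 < ψ := by linarith
  have hM0 : (0 : ℝ) < M := by exact_mod_cast hM
  have hMN : M ≤ N := by
    have : (M : ℝ) ≤ N := by rw [hN]; nlinarith
    exact_mod_cast this
  have hα : 0 < σ2 + w / ψ := by positivity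
  have hξ : 0 ≤ w / (σ2 * ψ) := by positivity
  -- For `k ≤ N - M` the shape `N - k` is at least `M ≥ 1`.
  have hkpos : ∀ k ∈ Finset.range (N - M + 1), (0 : ℝ) < ((N - k : ℕ) : ℝ) := fun k hk => by
    rw [Finset.mem_range] at hk
    exact_mod_cast (by omega : 0 < N - k)
  have hXm := fun i => (hX i).aemeasurable
  have hYm : AEMeasurable (fun ω => ∑ i, X i ω) P := by fun_prop
  have : IsProbabilityMeasure (P.map fun ω => ∑ i, X i ω) := Measure.isProbabilityMeasure_map hYm
  have hfin : ∀ k ∈ Finset.range (N - M + 1), IsFiniteMeasure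
      (ENNReal.ofReal (mixWeight M N (w / (σ2 * ψ)) k) •
        gammaMeasure (N - k : ℕ) (1 / (σ2 + w / ψ))) := fun k hk => by
    have := isProbabilityMeasure_gammaMeasure (hkpos k hk) (one_div_pos.2 hα)
    exact Measure.smul_finite _ ENNReal.ofReal_ne_top
  have : IsFiniteMeasure (∑ k ∈ Finset.range (N - M + 1),
      ENNReal.ofReal (mixWeight M N (w / (σ2 * ψ)) k) •
        gammaMeasure (N - k : ℕ) (1 / (σ2 + w / ψ))) := by
    refine ⟨?_⟩
    rw [Measure.finsetSum_apply]
    exact ENNReal.sum_lt_top.2 fun k hk => (hfin k hk).measure_univ_lt_top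
  refine ext_of_laplace_eq ?_ ?_ fun t ht => ?_
  · rw [ae_map_iff hYm measurableSet_Ici]
    have h : ∀ᵐ ω ∂P, ∀ i, 0 ≤ X i ω := ae_all_iff.2 fun i => by
      have := ae_nonneg_shadowedRicianLaw σ2 ψ w (p i) (q i)
      rw [← (hX i).map_eq] at this
      exact ae_of_ae_map (hXm i) this
    filter_upwards [h] with ω hω using Finset.sum_nonneg fun i _ => hω i
  · rw [ae_iff, Measure.finsetSum_apply]
    refine Finset.sum_eq_zero fun k _ => ?_
    rw [Measure.smul_apply, ae_iff.1 (ae_nonneg_gammaMeasure _ _), smul_zero]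
  · have hD : 0 < 1 + σ2 * t := by positivity
    have hu : 0 < 1 + (σ2 + w / ψ) * t := by positivity
    have hint : ∀ k ∈ Finset.range (N - M + 1), Integrable (fun x => Real.exp (-t * x))
        (ENNReal.ofReal (mixWeight M N (w / (σ2 * ψ)) k) •
          gammaMeasure (N - k : ℕ) (1 / (σ2 + w / ψ))) := fun k hk => by
      have := isProbabilityMeasure_gammaMeasure (hkpos k hk) (one_div_pos.2 hα)
      refine Integrable.smul_measure ?_ ENNReal.ofReal_ne_top
      refine Integrable.of_bound (C := 1) (by fun_prop) ?_
      filter_upwards [ae_nonneg_gammaMeasure ((N - k : ℕ) : ℝ) (1 / (σ2 + w / ψ))] with x hx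
      rw [Real.norm_eq_abs, Real.abs_exp, Real.exp_le_one_iff]
      nlinarith [mul_nonneg ht hx]
    rw [integral_finsetSum_measure hint, integral_map hYm (by fun_prop)]
    have hleft : ∫ ω, Real.exp (-t * ∑ i, X i ω) ∂P =
        ∏ i, ∫ x, Real.exp (-t * x) ∂shadowedRicianLaw σ2 ψ w (p i) (q i) := by
      have h := hind.mgf_sum₀ (t := -t) hXm Finset.univ
      simp only [mgf, Finset.sum_apply] at h
      rw [h]
      refine Finset.prod_congr rfl fun i _ => ?_
      exact (hX i).integral_comp (f := fun x => Real.exp (-t * x)) (by fun_prop)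
    have hright : ∀ k ∈ Finset.range (N - M + 1), ∫ x, Real.exp (-t * x)
        ∂(ENNReal.ofReal (mixWeight M N (w / (σ2 * ψ)) k) •
          gammaMeasure (N - k : ℕ) (1 / (σ2 + w / ψ))) =
        mixWeight M N (w / (σ2 * ψ)) k * (1 / (1 + (σ2 + w / ψ) * t)) ^ (N - k) := fun k hk => by
      rw [integral_smul_measure, integral_exp_gammaMeasure (hkpos k hk) (one_div_pos.2 hα)
        (by positivity), ENNReal.toReal_ofReal (mixWeight_nonneg M N hξ k), smul_eq_mul,
        Real.rpow_natCast]
      congr 2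
      field_simp
    rw [hleft, Finset.sum_congr rfl hright, sum_mixWeight_div_pow hMN hξ hu.ne']
    simp_rw [integral_exp_shadowedRicianLaw hσ hψ0 hw (hpq _) ht]
    -- The real exponent `ψ` becomes the integer `N = M ψ` only after the `M`-th power.
    rw [Finset.prod_const, Finset.card_univ, Fintype.card_fin, div_pow, ← Real.rpow_natCast,
      ← Real.rpow_mul (by positivity), mul_comm ψ, ← hN, Real.rpow_natCast, div_pow]
    -- Here `ξ + 1 = α / σ²`, which turns the binomial base into `1 + σ² t`.
    have e : (1 + (σ2 + w / ψ) * t + w / (σ2 * ψ)) / (w / (σ2 * ψ) + 1) = 1 + σ2 * t := by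
      field_simp
      ring
    rw [e, show (1 + σ2 * t) ^ N = (1 + σ2 * t) ^ (N - M) * (1 + σ2 * t) ^ M by
      rw [← pow_add]; congr 1; omega]
    field_simp

lemma mixture_real_Ioi {M N : ℕ} (hM : 1 ≤ M) (hMN : M ≤ N) {ξ α y : ℝ} (hξ : 0 ≤ ξ)
    (hα : 0 < α) (hy : 0 ≤ y) :
    (∑ k ∈ Finset.range (N - M + 1), ENNReal.ofReal (mixWeight M N ξ k) •
        gammaMeasure (N - k : ℕ) (1 / α)).real (Set.Ioi y) =
      ∑ k ∈ Finset.range (N - M + 1), mixWeight M N ξ k *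
        ∑ n ∈ Finset.range (N - k),
          Real.exp (-(y / α)) * ((y / α) ^ n / (n.factorial : ℝ)) := by
  have hgm : ∀ k ∈ Finset.range (N - M + 1),
      IsProbabilityMeasure (gammaMeasure (N - k : ℕ) (1 / α)) := fun k hk => by
    rw [Finset.mem_range] at hk
    exact isProbabilityMeasure_gammaMeasure (by exact_mod_cast (by omega : 0 < N - k))
      (one_div_pos.2 hα)
  rw [measureReal_def, Measure.finsetSum_apply, ENNReal.toReal_sum fun k hk => by
    have := hgm k hk
    exact ENNReal.mul_ne_top ENNReal.ofReal_ne_top (measure_ne_top _ _)]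
  refine Finset.sum_congr rfl fun k hk => ?_
  rw [Finset.mem_range] at hk
  obtain ⟨m, hm⟩ : ∃ m, N - k = m + 1 := ⟨N - k - 1, by omega⟩
  rw [Measure.smul_apply, smul_eq_mul, ENNReal.toReal_mul,
    ENNReal.toReal_ofReal (mixWeight_nonneg M N hξ k), ← measureReal_def, hm,
    gammaMeasure_real_Ioi (one_div_pos.2 hα) hy, ← Finset.mul_sum, one_div_mul_eq_div]

end SumLaw

/-! ### Distribution of the SINR -/

section NonnegVariable

variable {Ω : Type*} [MeasurableSpace Ω] {P : Measure Ω} [IsFiniteMeasure P] {W : Ω → ℝ}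

/-- For `t < 0` and `W ≥ 0` the variable `exp(t W)` is bounded by 1, so the whole open negative
half-line is admissible. -/
lemma neg_mem_interior_integrableExpSet (hW : AEMeasurable W P) (h0 : ∀ ω, 0 ≤ W ω) {s : ℝ}
    (hs : 0 < s) : -s ∈ interior (integrableExpSet W P) := by
  refine mem_interior.2 ⟨Set.Iio 0, fun t (ht : t < 0) => ?_, isOpen_Iio, by simpa using hs⟩
  refine Integrable.of_bound (C := 1) (by fun_prop) (ae_of_all _ fun ω => ?_)
  rw [Real.norm_eq_abs, Real.abs_exp, Real.exp_le_one_iff]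
  exact mul_nonpos_of_nonpos_of_nonneg ht.le (h0 ω)

lemma integrable_exp_neg_mul_pow (hW : AEMeasurable W P) (h0 : ∀ ω, 0 ≤ W ω) {s : ℝ}
    (hs : 0 < s) (n : ℕ) :
    Integrable (fun ω => Real.exp (-(s * W ω)) * ((s * W ω) ^ n / (n.factorial : ℝ))) P := by
  refine ((integrable_pow_mul_exp_of_mem_interior_integrableExpSet
    (neg_mem_interior_integrableExpSet hW h0 hs) n).const_mul
      (s ^ n / (n.factorial : ℝ))).congr (ae_of_all _ fun ω => ?_)
  simp only [neg_mul, mul_pow]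
  ring

/-- Poisson-type averages of a nonnegative variable through the derivatives of its Laplace
transform. -/
lemma integral_exp_neg_mul_pow (hW : AEMeasurable W P) (h0 : ∀ ω, 0 ≤ W ω) {f : ℝ → ℝ}
    (hf : ∀ t, 0 ≤ t → mgf W P (-t) = f t) {s : ℝ} (hs : 0 < s) (n : ℕ) :
    ∫ ω, Real.exp (-(s * W ω)) * ((s * W ω) ^ n / (n.factorial : ℝ)) ∂P =
      (-s) ^ n * iteratedDeriv n f s / (n.factorial : ℝ) := by
  -- Equality on `[0, ∞)` gives equality near `s > 0`, hence equality of all derivatives at `s`.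
  have he : f =ᶠ[𝓝 s] fun t => mgf W P (-t) := by
    filter_upwards [lt_mem_nhds hs] with t ht using (hf t ht.le).symm
  rw [he.iteratedDeriv_eq, iteratedDeriv_comp_neg,
    iteratedDeriv_mgf (neg_mem_interior_integrableExpSet hW h0 hs), smul_eq_mul, ← mul_assoc,
    ← mul_pow, mul_div_right_comm, ← integral_const_mul]
  refine integral_congr_ae (ae_of_all _ fun ω => ?_)
  simp only [neg_mul, mul_pow, mul_neg, mul_one, neg_neg]
  ring

end NonnegVariable

section Sinr

/-- The distribution function of a ratio of an Erlang mixture and an independent positive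
variable. -/
lemma cdf_mul_div_of_mixture {Ω : Type*} [MeasurableSpace Ω] {P : Measure Ω}
    [IsProbabilityMeasure P] {Y W : Ω → ℝ} (hY : AEMeasurable Y P) (hW : AEMeasurable W P)
    (hYW : IndepFun Y W P) (hW0 : ∀ ω, 0 < W ω) {M N : ℕ} (hM : 1 ≤ M) (hMN : M ≤ N) {ξ α : ℝ}
    (hξ : 0 ≤ ξ) (hα : 0 < α)
    (hlaw : P.map Y = ∑ k ∈ Finset.range (N - M + 1), ENNReal.ofReal (mixWeight M N ξ k) •
      gammaMeasure (N - k : ℕ) (1 / α))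
    {f : ℝ → ℝ} (hf : ∀ t, 0 ≤ t → mgf W P (-t) = f t) {g x : ℝ} (hg : 0 < g) (hx : 0 < x) :
    cdf (P.map fun ω => g * Y ω / W ω) x =
      1 - ∑ k ∈ Finset.range (N - M + 1), mixWeight M N ξ k *
        ∑ n ∈ Finset.range (N - k), (-(x / (α * g))) ^ n * iteratedDeriv n f (x / (α * g)) /
          (n.factorial : ℝ) := by
  have hm : AEMeasurable (fun ω => g * Y ω / W ω) P := by fun_prop
  have : IsProbabilityMeasure (P.map fun ω => g * Y ω / W ω) :=
    Measure.isProbabilityMeasure_map hm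
  have hs : 0 < x / (α * g) := by positivity
  have hset : (fun ω => g * Y ω / W ω) ⁻¹' Set.Ioi x = {ω | x / g * W ω < Y ω} := by
    ext ω
    simp only [Set.mem_preimage, Set.mem_Ioi, Set.mem_ofPred_eq]
    rw [lt_div_iff₀ (hW0 ω), div_mul_eq_mul_div, div_lt_iff₀ hg, mul_comm g]
  rw [cdf_eq_real, ← Set.compl_Ioi, probReal_compl_eq_one_sub measurableSet_Ioi,
    map_measureReal_apply_of_aemeasurable hm measurableSet_Ioi, hset,
    measureReal_mul_lt_of_indepFun hY hW hYW, hlaw]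
  congr 1
  -- The Erlang tail at the threshold `(x / g) W` with scale `α` has argument `s₀ W`.
  have e : ∀ ω, x / g * W ω / α = x / (α * g) * W ω := fun ω => by field_simp
  have hpt : ∀ ω, 0 ≤ x / g * W ω := fun ω => by have := hW0 ω; positivity
  simp_rw [fun ω => mixture_real_Ioi hM hMN hξ hα (hpt ω), e]
  have hint := integrable_exp_neg_mul_pow hW (fun ω => (hW0 ω).le) hs
  rw [integral_finsetSum _ fun k _ =>
    (integrable_finsetSum _ fun n _ => hint n).const_mul _]
  refine Finset.sum_congr rfl fun k _ => ?_
  rw [integral_const_mul, integral_finsetSum _ fun n _ => hint n]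
  congr 1
  exact Finset.sum_congr rfl fun n _ =>
    integral_exp_neg_mul_pow hW (fun ω => (hW0 ω).le) hf hs n

variable {Ω : Type*} [MeasurableSpace Ω] {P : Measure Ω} {L K : ℕ}
  {γI κI : Fin L → ℝ} {γJ κJ : Fin K → ℝ} {hI : Fin L → Ω → ℂ} {hJ : Fin K → Ω → ℂ}

/-- Independent interferers multiply, and the normalized noise `+ 1` supplies the factor `e^{-t}`.
-/
lemma mgf_interference (hγI : ∀ l, 0 ≤ γI l) (hκI : ∀ l, 0 ≤ κI l)
    (hγJ : ∀ k, 0 ≤ γJ k) (hκJ : ∀ k, 0 ≤ κJ k)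
    (hI_law : ∀ l, IsRician P (κI l) (hI l)) (hJ_law : ∀ k, IsRician P (κJ k) (hJ k))
    (hind : iIndepFun (Sum.elim (fun l ω => γI l * ‖hI l ω‖ ^ 2)
      (fun k ω => γJ k * ‖hJ k ω‖ ^ 2) : Fin L ⊕ Fin K → Ω → ℝ) P) {t : ℝ} (ht : 0 ≤ t) :
    mgf (fun ω => ∑ l, γI l * ‖hI l ω‖ ^ 2 + ∑ k, γJ k * ‖hJ k ω‖ ^ 2 + 1) P (-t) =
      deltaZero γI κI γJ κJ t := by
  have hm : ∀ i, AEMeasurable ((Sum.elim (fun l ω => γI l * ‖hI l ω‖ ^ 2)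
      (fun k ω => γJ k * ‖hJ k ω‖ ^ 2) : Fin L ⊕ Fin K → Ω → ℝ) i) P := by
    rintro (l | k)
    · have := (hI_law l).aemeasurable
      simp only [Sum.elim_inl]
      fun_prop
    · have := (hJ_law k).aemeasurable
      simp only [Sum.elim_inr]
      fun_prop
  have h := hind.mgf_sum₀ (t := -t) hm Finset.univ
  rw [Fintype.prod_sum_type] at h
  simp only [Sum.elim_inl, Sum.elim_inr, (hI_law _).mgf_eq (hκI _) (hγI _) ht,
    (hJ_law _).mgf_eq (hκJ _) (hγJ _) ht] at h
  rw [mgf_add_const, mul_one, deltaZero, mul_assoc, ← h, mul_comm]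
  congr 2
  ext ω
  simp [Fintype.sum_sum_type]

end Sinr

end G2A

end

/-! ### Assembly of the main theorem -/

open G2A in
theorem theorem1
    {Ω : Type*} [MeasurableSpace Ω] (P : Measure Ω) [IsProbabilityMeasure P]
    (M L K : ℕ) (hM : 1 ≤ M)
    -- transmit powers, path losses, `K`-factors, noise variance
    (pS ℓS κS noise : ℝ) (hpS : 0 < pS) (hℓS : 0 < ℓS) (hκS : 0 < κS) (hnoise : 0 < noise)
    (pI ℓI κI : Fin L → ℝ) (hpI : ∀ l, 0 ≤ pI l) (hℓI : ∀ l, 0 < ℓI l) (hκI : ∀ l, 0 ≤ κI l)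
    (pJ ℓJ κJ : Fin K → ℝ) (hpJ : ∀ k, 0 ≤ pJ k) (hℓJ : ∀ k, 0 < ℓJ k) (hκJ : ∀ k, 0 ≤ κJ k)
    -- the `M` antenna channels, and the normalized power gain under MRT beamforming
    (hS : Fin M → Ω → ℂ) (θ : Fin M → ℝ) (hS_law : ∀ m, G2A.IsRician P κS (hS m))
    (hS_indep : iIndepFun hS P)
    (gain : Ω → ℝ)
    (hgain : ∀ ω, gain ω = G2A.mrtPowerGain (fun m => G2A.channel ℓS (θ m) (hS m ω)) / ℓS)
    -- its first two moments and the trade-off parameter, with `N = M ψ`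
    (μ₁ μ₂ : ℝ) (hμ₁ : μ₁ = ∫ ω, gain ω ∂P) (hμ₂ : μ₂ = ∫ ω, gain ω ^ 2 ∂P)
    (ψ : ℝ) (hψ : 1 < ψ) (N : ℕ) (hN : (N : ℝ) = M * ψ)
    (hσ : 0 < G2A.sisrSigmaSq M ψ μ₁ μ₂)
    -- the shadowed Rician summands
    (p q : Fin M → ℝ) (hpq : ∀ i, p i ^ 2 + q i ^ 2 = 1)
    (X : Fin M → Ω → ℝ)
    (hX_law : ∀ i, HasLaw (X i) (G2A.shadowedRicianLaw (G2A.sisrSigmaSq M ψ μ₁ μ₂) ψ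
      (G2A.sisrSpread M ψ μ₁ μ₂) (p i) (q i)) P)
    -- the interferers
    (hI : Fin L → Ω → ℂ) (hI_law : ∀ l, G2A.IsRician P (κI l) (hI l))
    (hJ : Fin K → Ω → ℂ) (hJ_law : ∀ k, G2A.IsRician P (κJ k) (hJ k))
    (h_indep : iIndepFun
      (Sum.elim (fun i ω => ((X i ω : ℝ) : ℂ)) (Sum.elim hI hJ) :
        Fin M ⊕ (Fin L ⊕ Fin K) → Ω → ℂ) P)
    (γS : ℝ) (hγS : γS = G2A.avgSNR pS ℓS noise)
    (γI : Fin L → ℝ) (hγI : ∀ l, γI l = G2A.avgSNR (pI l) (ℓI l) noise)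
    (γJ : Fin K → ℝ) (hγJ : ∀ k, γJ k = G2A.avgSNR (pJ k) (ℓJ k) noise) :
    -- the sum of the `X i` has the first two moments of the MRT gain, which are explicit
    (μ₁ = M ∧ μ₂ = M ^ 2 + M * (2 * κS + 1) / (κS + 1) ^ 2 ∧
      ∫ ω, ∑ i, X i ω ∂P = μ₁ ∧ ∫ ω, (∑ i, X i ω) ^ 2 ∂P = μ₂) ∧
    -- the explicit form of the derivatives
    (∀ (n : ℕ) (s : ℝ), 0 ≤ s →
      G2A.delta γI κI γJ κJ n s = G2A.deltaExpansion γI κI γJ κJ n s) ∧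
    -- the CDF of the SINR
    (∀ x : ℝ, 0 < x →
      cdf (P.map fun ω =>
          G2A.sinr γS γI γJ (∑ i, X i ω) (fun l => hI l ω) (fun k => hJ k ω)) x =
        1 - ∑ k ∈ Finset.range (N - M + 1), G2A.sisrChi M N ψ μ₁ μ₂ k *
          ∑ n ∈ Finset.range (N - k),
            (-(x / (G2A.sisrAlpha M ψ μ₁ μ₂ * γS))) ^ n *
              G2A.delta γI κI γJ κJ n (x / (G2A.sisrAlpha M ψ μ₁ μ₂ * γS)) / (n.factorial : ℝ)) := by
  have hM0 : (0 : ℝ) < M := by exact_mod_cast hM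
  have hψ0 : 0 < ψ := by linarith
  have hγI0 : ∀ l, 0 ≤ γI l := fun l => by
    rw [hγI]; exact div_nonneg (mul_nonneg (hpI l) (hℓI l).le) hnoise.le
  have hγJ0 : ∀ k, 0 ≤ γJ k := fun k => by
    rw [hγJ]; exact div_nonneg (mul_nonneg (hpJ k) (hℓJ k).le) hnoise.le
  have hγS0 : 0 < γS := by rw [hγS]; exact div_pos (mul_pos hpS hℓS) hnoise
  -- the moments of the MRT gain
  have hgain' : ∀ ω, gain ω = ∑ m, ‖hS m ω‖ ^ 2 := fun ω => by
    rw [hgain, mrtPowerGain_channel_div hℓS]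
  have hmom := fun m => (hS_law m).moments hκS.le
  have hSU : iIndepFun (fun m ω => ‖hS m ω‖ ^ 2) P :=
    hS_indep.comp (fun _ z => ‖z‖ ^ 2) fun _ => by fun_prop
  obtain ⟨hg1, hg2⟩ := moments_sum_of_iIndepFun hSU (fun m => (hmom m).1) (fun m => (hmom m).2.1)
    (fun m => (hmom m).2.2)
  have h₁ : μ₁ = M := by simp_rw [hμ₁, hgain', hg1]
  have h₂ : μ₂ = M ^ 2 + M * (2 * κS + 1) / (κS + 1) ^ 2 := by
    simp_rw [hμ₂, hgain', hg2, mul_div_assoc]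
  -- the moment-matched parameters
  have hw_eq := sisrSpread_eq (ψ := ψ) hM hκS h₁ h₂
  have hσ_eq := sisrSigmaSq_eq (ψ := ψ) (μ₂ := μ₂) hM h₁
  have hw : 0 < sisrSpread M ψ μ₁ μ₂ := by
    have := Real.sqrt_pos.2 hψ0
    have := Real.sqrt_pos.2 (sub_pos.2 hψ)
    rw [hw_eq]
    positivity
  have hα_eq := sisrAlpha_eq hM h₁ hσ hw hψ0
  have hξ_eq := sisrXi_eq hM h₁ hσ hw
  -- Together with `σ² = 1 - Ω`, this is all that the matching of second moments needs to know about
  -- `Ω`.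
  have hw_sq : sisrSpread M ψ μ₁ μ₂ ^ 2 * (ψ - 1) / ψ = (κS / (κS + 1)) ^ 2 := by
    have : ψ - 1 ≠ 0 := by linarith
    rw [hw_eq, mul_pow, div_pow, Real.sq_sqrt hψ0.le, Real.sq_sqrt (by linarith)]
    field_simp
  have hχ : ∀ k, sisrChi M N ψ μ₁ μ₂ k = mixWeight M N
      (sisrSpread M ψ μ₁ μ₂ / (sisrSigmaSq M ψ μ₁ μ₂ * ψ)) k := fun k => by
    rw [sisrChi, hξ_eq, mixWeight]
  rw [hα_eq]
  simp_rw [hχ]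
  clear hα_eq hξ_eq hw_eq hχ
  generalize sisrSpread M ψ μ₁ μ₂ = w at *
  generalize sisrSigmaSq M ψ μ₁ μ₂ = σ2 at *
  -- independence of the shadowed Rician variables and the interferers
  let Z : Fin M ⊕ (Fin L ⊕ Fin K) → Ω → ℝ :=
    Sum.elim X (Sum.elim (fun l ω => γI l * ‖hI l ω‖ ^ 2) (fun k ω => γJ k * ‖hJ k ω‖ ^ 2))
  have hZ : iIndepFun Z P := by
    -- The `X i` enter the joint family as complex numbers; the real part recovers them.
    have h := h_indep.comp (γ := fun _ => ℝ) (Sum.elim (fun _ z => z.re)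
      (Sum.elim (fun l z => γI l * ‖z‖ ^ 2) (fun k z => γJ k * ‖z‖ ^ 2))) (by
        rintro (i | l | k) <;> simp only [Sum.elim_inl, Sum.elim_inr] <;> fun_prop)
    convert! h using 1
    ext i ω
    rcases i with i | l | k <;> simp [Z]
  have hZm : ∀ i, AEMeasurable (Z i) P := by
    rintro (i | l | k)
    · exact (hX_law i).aemeasurable
    · have := (hI_law l).aemeasurable
      simp only [Z, Sum.elim_inl, Sum.elim_inr]
      fun_prop
    · have := (hJ_law k).aemeasurable
      simp only [Z, Sum.elim_inr]
      fun_prop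
  have hXind : iIndepFun X P := hZ.precomp (g := Sum.inl) Sum.inl_injective
  have hIJind := hZ.precomp (g := Sum.inr) Sum.inr_injective
  refine ⟨⟨h₁, h₂, ?_⟩, fun n s hs =>
    delta_eq_deltaExpansion (mem_regularSet_of_nonneg hγI0 hκI hγJ0 hκJ hs) n, fun x hx => ?_⟩
  · have hXmom := moments_sum_of_iIndepFun (V := (2 * κS + 1) / (κS + 1) ^ 2) hXind
      (fun i => by
        have h := memLp_two_shadowedRicianLaw σ2 (p i) (q i) hψ0 hw
        rw [← (hX_law i).map_eq, memLp_map_measure_iff (by fun_prop)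
          (hX_law i).aemeasurable] at h
        exact h)
      (fun i => by
        rw [(hX_law i).integral_eq, integral_id_shadowedRicianLaw hσ.le hψ0 hw (hpq i), hσ_eq]
        ring)
      (fun i => by
        have h := (hX_law i).integral_comp (f := fun x => x ^ 2) (by fun_prop)
        rw [integral_sq_shadowedRicianLaw hσ.le hψ0 hw (hpq i)] at h
        refine h.trans ?_
        have e : (2 * κS + 1) / (κS + 1) ^ 2 = 1 - (κS / (κS + 1)) ^ 2 := by
          field_simp
          ring
        -- With `σ² = 1 - w` the second moment of `X i` reduces to `2 - w² (ψ - 1) / ψ`.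
        rw [e, ← hw_sq, hσ_eq]
        field_simp
        ring)
    rw [hXmom.1, hXmom.2, h₁, h₂, mul_div_assoc]
    exact ⟨rfl, rfl⟩
  · have hMN : M ≤ N := by
      have : (M : ℝ) ≤ N := by rw [hN]; nlinarith
      exact_mod_cast this
    have hYm : AEMeasurable (fun ω => ∑ i, X i ω) P := by
      have := fun i => (hX_law i).aemeasurable
      fun_prop
    have hWm : AEMeasurable
        (fun ω => ∑ l, γI l * ‖hI l ω‖ ^ 2 + ∑ k, γJ k * ‖hJ k ω‖ ^ 2 + 1) P := by
      have := fun l => (hI_law l).aemeasurable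
      have := fun k => (hJ_law k).aemeasurable
      fun_prop
    have hYW : IndepFun (fun ω => ∑ i, X i ω)
        (fun ω => ∑ l, γI l * ‖hI l ω‖ ^ 2 + ∑ k, γJ k * ‖hJ k ω‖ ^ 2 + 1) P := by
      have h := (indepFun_sum_inl_sum_inr hZ hZm).comp measurable_id (measurable_add_const (1 : ℝ))
      convert! h using 1
      ext ω
      simp [Z, Fintype.sum_sum_type]
    have hW0 : ∀ ω, 0 < ∑ l, γI l * ‖hI l ω‖ ^ 2 + ∑ k, γJ k * ‖hJ k ω‖ ^ 2 + 1 := fun ω => by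
      have h1 : 0 ≤ ∑ l, γI l * ‖hI l ω‖ ^ 2 :=
        Finset.sum_nonneg fun l _ => mul_nonneg (hγI0 l) (by positivity)
      have h2 : 0 ≤ ∑ k, γJ k * ‖hJ k ω‖ ^ 2 :=
        Finset.sum_nonneg fun k _ => mul_nonneg (hγJ0 k) (by positivity)
      linarith
    exact cdf_mul_div_of_mixture hYm hWm hYW hW0 hM hMN (by positivity) (by positivity)
      (map_sum_shadowedRician hσ hψ hw hM hN hpq hX_law hXind)
      (fun t ht => mgf_interference hγI0 hκI hγJ0 hκJ hI_law hJ_law hIJind ht) hγS0 hx
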